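/- Let $n\ge 1$ and $k\ge 0$ be integers. For a multiset $\lambda$ of $n$ real numbers let $S_l(\lambda)$ be its $l$-th elementary symmetric function ($S_0=1$, $S_l=0$ for $l>n$), put $Q_k=S_{k+1}/S_k$, and let $\Gamma_{k+1}$ be the cone of all $\lambda$ with $S_l(\lambda)>0$ for $l=1,\dots,k+1$. There is a constant $C=C(k,n)>0$, depending only on $k$ and $n$, with the following property. Let $r>0$, let $B(0,r)\subset\mathbb R^n$ be the open Euclidean ball, and let $u\in C^3(B(0,r))$ satisfy $u\ge 0$ and $M:=\sup_{B(0,r)}u<\infty$. For $x\in B(0,r)$ let $\lambda(x)$ denote the principal curvatures of $\mathrm{graph}(u)\subset\mathbb R^{n+1}$ at $(x,u(x))$ with respect to the upward unit normal $(-Du,1)/\sqrt{1+|Du|^2}$, that is, the eigenvalues (with multiplicity) of $g^{-1}h$, where $g_{ij}=\delta_{ij}+u_iu_j$ and $h_{ij}=u_{ij}/\sqrt{1+|Du|^2}$. Assume that for every $x\in B(0,r)$ $$\lambda(x)\in\Gamma_{k+1}\qquad\text{and}\qquad Q_k(\lambda(x))=\frac{1}{\sqrt{1+|Du(x)|^2}},$$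 i.e. $\mathrm{graph}(u)$ is a $Q_k$-translator with velocity $e_{n+1}$. Then $$|Du(0)|\le\exp\left(\frac{CM}{r}+\frac{CM^2}{r^2}\right).$$ -/

import Mathlib

noncomputable section

namespace QkTranslator

/-- The Hessian matrix `u_{ij}(x)` of `u : ℝⁿ → ℝ`. -/
def hessian {n : ℕ} (u : EuclideanSpace ℝ (Fin n) → ℝ) (x : EuclideanSpace ℝ (Fin n)) :
    Matrix (Fin n) (Fin n) ℝ :=
  Matrix.of fun i j =>
    fderiv ℝ (fderiv ℝ u) x (EuclideanSpace.single i 1) (EuclideanSpace.single j 1)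

/-- The area element `w = √(1 + |Du|²)` of the graph of `u`. -/
def areaElement {n : ℕ} (u : EuclideanSpace ℝ (Fin n) → ℝ) (x : EuclideanSpace ℝ (Fin n)) : ℝ :=
  Real.sqrt (1 + ‖gradient u x‖ ^ 2)

/-- The first fundamental form `g_{ij} = δ_{ij} + u_i u_j` of the graph of `u`, in the
parametrization `x ↦ (x, u x)`. -/
def firstFundamentalForm {n : ℕ} (u : EuclideanSpace ℝ (Fin n) → ℝ)
    (x : EuclideanSpace ℝ (Fin n)) : Matrix (Fin n) (Fin n) ℝ :=
  Matrix.of fun i j => (if i = j then 1 else 0) + gradient u x i * gradient u x j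

/-- The second fundamental form `h_{ij} = u_{ij} / w` of the graph of `u` with respect to the
upward unit normal `ν = (-Du, 1) / w`; convex functions have nonnegative curvatures. -/
def secondFundamentalForm {n : ℕ} (u : EuclideanSpace ℝ (Fin n) → ℝ)
    (x : EuclideanSpace ℝ (Fin n)) : Matrix (Fin n) (Fin n) ℝ :=
  (areaElement u x)⁻¹ • hessian u x

/-- The matrix `g⁻¹ h` of the Weingarten map of the graph of `u`. (The matrix `g` is always
positive definite, hence invertible.) -/
def weingarten {n : ℕ} (u : EuclideanSpace ℝ (Fin n) → ℝ) (x : EuclideanSpace ℝ (Fin n)) :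
    Matrix (Fin n) (Fin n) ℝ :=
  (firstFundamentalForm u x)⁻¹ * secondFundamentalForm u x

/-- The principal curvatures of the graph of `u` at `(x, u x)`: the eigenvalues of the Weingarten
map, with multiplicity. Where `u` is `C²` the Weingarten map is self-adjoint with respect to `g`,
so there are exactly `n` of them. -/
def principalCurvatures {n : ℕ} (u : EuclideanSpace ℝ (Fin n) → ℝ)
    (x : EuclideanSpace ℝ (Fin n)) : Multiset ℝ :=
  (weingarten u x).charpoly.roots

/-- The cone `Γ_m`: all elementary symmetric functions `S_1, …, S_m` are positive
(`S_0 = 1`, and `S_l = 0` when `l` exceeds the number of entries). -/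
def InCone (m : ℕ) (curv : Multiset ℝ) : Prop :=
  ∀ l : ℕ, 1 ≤ l → l ≤ m → 0 < curv.esymm l

/-- The quotient `Q_k = S_{k+1} / S_k` of elementary symmetric functions. -/
def Q (k : ℕ) (curv : Multiset ℝ) : ℝ :=
  curv.esymm (k + 1) / curv.esymm k

/-- The graph of `u` over `Ω` is a `Q_k`-translator with unit velocity `e_{n+1}`:
`Q_k = ⟨ν, e_{n+1}⟩ = 1 / √(1 + |Du|²)`. -/
def IsGraphTranslatorOn {n : ℕ} (k : ℕ) (u : EuclideanSpace ℝ (Fin n) → ℝ)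
    (Ω : Set (EuclideanSpace ℝ (Fin n))) : Prop :=
  ∀ x ∈ Ω, Q k (principalCurvatures u x) = 1 / areaElement u x

end QkTranslator

end

/-! ### Newton's inequality and the cones `Γ_m`. -/

namespace QkTranslator

section

open Polynomial

/-! The proof applies the maximum principle to a barrier. For ρ < r consider (exp(Kφ) − 1)·√(1 +
|Du|²), where φ = 1 − |y|²/ρ² + a(u − M) and a = 1/(5M). It is positive at the centre and
nonpositive on the sphere of radius ρ, so it has an interior maximum x.

At x take a basis that is orthonormal for g and diagonalizes D²u with entries μ. By homogeneity of
Q_k the area element drops out, and the equation becomes S_{k+1}(μ) = S_k(μ). Its linearization has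
coefficients F_i = S_k − S_{k−1}, evaluated on the entries other than μ_i. In the F-weighted sum of
the second-order conditions at x, the third derivatives of u cancel against the terms μ_i² p_i², p_i
= du(e_i). What survives is K Σ F_i Φ_i² ≤ (2/ρ²) Σ F_i, with Φ_i = dφ(e_i).

If |Du(x)| is large, Σ p_i Φ_i is bounded below. The first-order condition makes Φ_i a positive
multiple of −μ_i p_i, so only indices with μ_i ≤ 0 help. For these, Newton's inequality gives Σ F_j
≤ (n+1)(k+1) F_i (`sum_cofactor_le_of_nonpos`), uniformly in μ. Cauchy–Schwarz
(`weighted_cauchy_schwarz`) then contradicts the choice of K, a multiple of M²/ρ². Hence |Du(x)| is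
controlled (`gradient_lt_at_max`); comparing the barrier at x and at 0 and letting ρ → r gives
exp(CM²/r²). The term CM/r is only slack. -/

theorem esymm_cons_succ (a : ℝ) (s : Multiset ℝ) (l : ℕ) :
    (a ::ₘ s).esymm (l + 1) = s.esymm (l + 1) + a * s.esymm l := by
  simp only [Multiset.esymm, Multiset.powersetCard_cons, Multiset.map_add, Multiset.sum_add,
    Multiset.map_map, Function.comp_def, Multiset.prod_cons, Multiset.sum_map_mul_left]

theorem esymm_zero_index (s : Multiset ℝ) : s.esymm 0 = 1 := by
  simp [Multiset.esymm]

theorem esymm_eq_zero_of_card_lt (s : Multiset ℝ) {l : ℕ} (h : s.card < l) : s.esymm l = 0 := by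
  simp [Multiset.esymm, Multiset.powersetCard_eq_empty l h]

/-- The generating polynomial `∏ (1 + a X)` of the elementary symmetric functions. -/
theorem coeff_prod_one_add (s : Multiset ℝ) (l : ℕ) :
    (s.map fun a => 1 + C a * X).prod.coeff l = s.esymm l := by
  induction s using Multiset.induction_on generalizing l with
  | empty =>
    rcases l with _ | l
    · simp [Multiset.esymm]
    · rw [esymm_eq_zero_of_card_lt _ (by simp)]; simp [coeff_one]
  | cons a s ih =>
    rw [Multiset.map_cons, Multiset.prod_cons, add_mul, one_mul, coeff_add, ih, mul_assoc,
      coeff_C_mul]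
    rcases l with _ | l
    · simp [esymm_zero_index]
    · rw [coeff_X_mul, ih, esymm_cons_succ]

theorem splits_derivative {p : ℝ[X]} (hp : p.Splits) : (derivative p).Splits := by
  rcases Nat.eq_zero_or_pos p.natDegree with h | h
  · rw [derivative_of_natDegree_zero h]; exact Splits.zero
  · rw [splits_iff_card_roots] at hp ⊢
    have h1 := card_roots_le_derivative p
    have h2 := (derivative p).card_roots'
    have h3 := natDegree_derivative_lt (p := p) (by omega)
    omega

theorem splits_iterate_derivative {p : ℝ[X]} (hp : p.Splits) (j : ℕ) :
    (derivative^[j] p).Splits := by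
  induction j with
  | zero => simpa
  | succ j ih => rw [Function.iterate_succ_apply']; exact splits_derivative ih

/-- Laguerre's inequality at `0` for a product of real linear factors. -/
theorem laguerre_prod (s : Multiset ℝ) (q : ℝ[X]) (hq : q = (s.map fun a => X - C a).prod) :
    0 ≤ q.coeff 1 ^ 2 - 2 * q.coeff 0 * q.coeff 2 ∧
      q.coeff 1 ^ 2 ≤ (s.card : ℝ) * (q.coeff 1 ^ 2 - 2 * q.coeff 0 * q.coeff 2) := by
  induction s using Multiset.induction_on generalizing q with
  | empty => subst hq; simp [coeff_one]
  | cons a s ih =>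
    rw [Multiset.map_cons, Multiset.prod_cons] at hq
    obtain ⟨ih0, ih⟩ := ih _ rfl
    set p := (s.map fun a => X - C a).prod
    have c0 : q.coeff 0 = -a * p.coeff 0 := by simp [hq, sub_mul]
    have c1 : q.coeff 1 = p.coeff 0 - a * p.coeff 1 := by
      rw [hq, sub_mul, coeff_sub, coeff_C_mul, coeff_X_mul]
    have c2 : q.coeff 2 = p.coeff 1 - a * p.coeff 2 := by
      rw [hq, sub_mul, coeff_sub, coeff_C_mul, coeff_X_mul]
    rw [c0, c1, c2, Multiset.card_cons]
    push_cast
    have hd : (0 : ℝ) ≤ s.card := Nat.cast_nonneg _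
    generalize (s.card : ℝ) = d at *
    generalize p.coeff 0 = x at *
    generalize p.coeff 1 = y at *
    generalize p.coeff 2 = z at *
    have e : (x - a * y) ^ 2 - 2 * (-a * x) * (y - a * z) =
        x ^ 2 + a ^ 2 * (y ^ 2 - 2 * x * z) := by ring
    rw [e]
    generalize y ^ 2 - 2 * x * z = D at *
    have h5 : 0 ≤ a ^ 2 * D := mul_nonneg (sq_nonneg _) ih0
    refine ⟨by positivity, ?_⟩
    rcases hd.eq_or_lt with rfl | hd
    · have hy : y = 0 := by nlinarith [sq_nonneg y]
      subst hy
      linarith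
    · have h6 : 0 ≤ (d + 1) * (a ^ 2 * (d * D - y ^ 2)) :=
        mul_nonneg (by linarith) (mul_nonneg (sq_nonneg _) (by linarith))
      have h7 : 0 ≤ (d * x + a * y) ^ 2 := sq_nonneg _
      -- For nonzero roots the claim is Cauchy–Schwarz for their reciprocals; the induction also
      -- covers zero roots. Multiplying by d makes the gap exactly the sum of `h6` and a square.
      have h8 : 0 ≤ d * ((d + 1) * (x ^ 2 + a ^ 2 * D) - (x - a * y) ^ 2) := by
        linear_combination h6 + h7
      linarith [nonneg_of_mul_nonneg_right h8 hd]

theorem laguerre_zero {q : ℝ[X]} (hq : q.Splits) {d : ℕ} (hd : q.natDegree ≤ d) :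
    q.coeff 1 ^ 2 ≤ (d : ℝ) * (q.coeff 1 ^ 2 - 2 * q.coeff 0 * q.coeff 2) := by
  obtain ⟨h0, h1⟩ := laguerre_prod q.roots _ rfl
  have hcard := splits_iff_card_roots.1 hq
  have e := C_leadingCoeff_mul_prod_multiset_X_sub_C hcard
  set p := (q.roots.map fun a => X - C a).prod
  have hc : ∀ l, q.coeff l = q.leadingCoeff * p.coeff l := fun l => by
    rw [← coeff_C_mul, e]
  rw [hc 0, hc 1, hc 2]
  have h2 : p.coeff 1 ^ 2 ≤ (d : ℝ) * (p.coeff 1 ^ 2 - 2 * p.coeff 0 * p.coeff 2) :=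
    h1.trans (mul_le_mul_of_nonneg_right (by rw [hcard]; exact_mod_cast hd) h0)
  have h3 := mul_le_mul_of_nonneg_left h2 (sq_nonneg q.leadingCoeff)
  linear_combination h3

/-- **Newton's inequality** for the elementary symmetric functions of real numbers. -/
theorem newton_inequality (s : Multiset ℝ) (m : ℕ) :
    (m + 2 : ℝ) * (s.esymm m * s.esymm (m + 2)) ≤ (m + 1) * s.esymm (m + 1) ^ 2 := by
  rcases lt_or_ge s.card (m + 2) with h | h
  · rw [esymm_eq_zero_of_card_lt s h]
    simp only [mul_zero]
    positivity
  -- After j derivatives ∏(X + a) has degree m + 2, is still real-rooted, and its three lowest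
  -- coefficients are multiples of S_{m+2}, S_{m+1}, S_m, so Laguerre at 0 applies.
  obtain ⟨j, hj⟩ := Nat.exists_eq_add_of_le' h
  set p : ℝ[X] := (s.map fun a => X + C a).prod with hp
  have hs : p.Splits := by
    rw [hp]
    refine Splits.multisetProd fun f hf => ?_
    obtain ⟨a, -, rfl⟩ := Multiset.mem_map.1 hf
    exact Splits.X_add_C a
  have hdeg : p.natDegree = s.card := by
    rw [hp, natDegree_multiset_prod_of_monic]
    · simp
    · intro f hf
      obtain ⟨a, -, rfl⟩ := Multiset.mem_map.1 hf
      exact monic_X_add_C a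
  have hq := splits_iterate_derivative hs j
  have hqd : (derivative^[j] p).natDegree ≤ m + 2 := by
    refine (natDegree_iterate_derivative p j).trans ?_
    omega
  have hL := laguerre_zero hq hqd
  simp only [coeff_iterate_derivative, nsmul_eq_mul] at hL
  rw [hp, Multiset.prod_X_add_C_coeff s (k := 0 + j) (by omega),
    Multiset.prod_X_add_C_coeff s (k := 1 + j) (by omega),
    Multiset.prod_X_add_C_coeff s (k := 2 + j) (by omega),
    show s.card - (0 + j) = m + 2 by omega, show s.card - (1 + j) = m + 1 by omega,
    show s.card - (2 + j) = m by omega] at hL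
  have d0 : (((0 + j).descFactorial j : ℕ) : ℝ) = (j.factorial : ℝ) := by
    rw [zero_add, Nat.descFactorial_self]
  have d1 : (((1 + j).descFactorial j : ℕ) : ℝ) = (j + 1) * (j.factorial : ℝ) := by
    have := Nat.factorial_mul_descFactorial (n := 1 + j) (k := j) (by omega)
    rw [show 1 + j - j = 1 by omega, Nat.factorial_one, one_mul, add_comm 1 j,
      Nat.factorial_succ] at this
    rw [add_comm 1 j, this]; push_cast; ring
  have d2 : 2 * (((2 + j).descFactorial j : ℕ) : ℝ) = (j + 2) * ((j + 1) * (j.factorial : ℝ)) := by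
    have := Nat.factorial_mul_descFactorial (n := 2 + j) (k := j) (by omega)
    rw [show 2 + j - j = 2 by omega, Nat.factorial_two, add_comm 2 j, Nat.factorial_succ,
      Nat.factorial_succ] at this
    rw [add_comm 2 j]
    have h2 := congrArg (Nat.cast (R := ℝ)) this
    push_cast at h2
    rw [h2]; ring
  rw [d0, d1] at hL
  have hf : (0 : ℝ) < j.factorial := by exact_mod_cast j.factorial_pos
  generalize s.esymm m = x at *
  generalize s.esymm (m + 1) = y at *
  generalize s.esymm (m + 2) = z at *
  -- Laguerre yields the sharp inequality, with an extra factor (j + 1)/(j + 2). Dropping it to get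
  -- a constant independent of the number of entries requires x z > 0; otherwise the claim is
  -- trivial.
  rcases le_or_gt (x * z) 0 with hxz | hxz
  · have : (m + 2 : ℝ) * (x * z) ≤ 0 := mul_nonpos_of_nonneg_of_nonpos (by positivity) hxz
    exact this.trans (by positivity)
  · push_cast at hL
    have hk : 0 < (j.factorial : ℝ) ^ 2 * (j + 1) := by positivity
    have h1 : (j.factorial : ℝ) ^ 2 * (j + 1) * ((j + 2) * ((m + 2 : ℝ) * (x * z))) ≤
        (j.factorial : ℝ) ^ 2 * (j + 1) * ((j + 1) * ((m + 1) * y ^ 2)) := by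
      linear_combination hL - (m + 2 : ℝ) * (j.factorial : ℝ) * z * x * d2
    have h2 := le_of_mul_le_mul_left h1 hk
    have h3 : 0 ≤ (m + 2 : ℝ) * (x * z) := by positivity
    have hj1 : (0 : ℝ) < j + 1 := by positivity
    refine le_of_mul_le_mul_left ?_ hj1
    linarith

/-- If the top function y of s were nonpositive, the two positivity conditions y + ax > 0 and z + ay
> 0 would force xz > y², against Newton. -/
theorem inCone_of_cons {m : ℕ} {a : ℝ} {s : Multiset ℝ} (h : InCone (m + 1) (a ::ₘ s)) :
    InCone m s := by
  induction m with
  | zero => intro l h1 h2; omega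
  | succ m ih =>
    have ih' := ih fun l h1 h2 => h l h1 (by omega)
    intro l h1 h2
    rcases Nat.lt_or_ge l (m + 1) with hl | hl
    · exact ih' l h1 (by omega)
    obtain rfl : l = m + 1 := by omega
    have hx : 0 < s.esymm m := by
      rcases Nat.eq_zero_or_pos m with rfl | hm
      · rw [esymm_zero_index]; exact one_pos
      · exact ih' m hm le_rfl
    have e1 := h (m + 1) (by omega) (by omega)
    have e2 := h (m + 2) (by omega) (by omega)
    rw [esymm_cons_succ] at e1 e2
    have hN := newton_inequality s m
    generalize s.esymm m = x at *
    generalize s.esymm (m + 1) = y at *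
    generalize s.esymm (m + 2) = z at *
    by_contra! hy
    have h3 : y ^ 2 < x * z := by
      have := mul_pos hx e2
      nlinarith [mul_nonneg (neg_nonneg.2 hy) e1.le]
    have hm : (0 : ℝ) ≤ m := Nat.cast_nonneg m
    nlinarith [sq_nonneg y]

/-! ### Coefficients of the linearized equation. -/

/-- `S_{l-1}`, with the convention `S_{-1} = 0`. -/
def esymmPred (s : Multiset ℝ) : ℕ → ℝ
  | 0 => 0
  | l + 1 => s.esymm l

/-- The cofactor `S_k - S_{k-1}`. -/
def cofactor (k : ℕ) (s : Multiset ℝ) : ℝ := s.esymm k - esymmPred s k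

theorem esymm_cons (a : ℝ) (s : Multiset ℝ) (l : ℕ) :
    (a ::ₘ s).esymm l = s.esymm l + a * esymmPred s l := by
  rcases l with _ | l
  · simp [esymmPred, esymm_zero_index]
  · exact esymm_cons_succ a s l

theorem InCone.esymm_pos {m : ℕ} {s : Multiset ℝ} (h : InCone m s) {l : ℕ} (hl : l ≤ m) :
    0 < s.esymm l := by
  rcases Nat.eq_zero_or_pos l with rfl | h0
  · rw [esymm_zero_index]; exact one_pos
  · exact h l h0 hl

theorem InCone.esymmPred_nonneg {m : ℕ} {s : Multiset ℝ} (h : InCone m s) :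
    0 ≤ esymmPred s m := by
  rcases m with _ | m
  · exact le_rfl
  · exact (h.esymm_pos (Nat.le_succ m)).le

/-- Eliminating a through the equation turns the product on the right into S_k² − S_{k−1}S_{k+1},
all evaluated on s. Newton bounds this below by S_k²/(k + 1). -/
theorem sq_esymm_le_cofactor {k : ℕ} {a : ℝ} {s : Multiset ℝ}
    (he : (a ::ₘ s).esymm (k + 1) = (a ::ₘ s).esymm k) :
    s.esymm k ^ 2 ≤ (k + 1) * ((a ::ₘ s).esymm k * cofactor k s) := by
  rcases k with _ | k
  · simp [cofactor, esymmPred, esymm_zero_index]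
  · have hN := newton_inequality s k
    rw [esymm_cons_succ, esymm_cons_succ] at he
    rw [esymm_cons_succ]
    simp only [cofactor, esymmPred]
    push_cast
    linear_combination hN - (k + 2) * s.esymm k * he

variable {n : ℕ}

/-- The multiset of all `μ j` with `j ≠ i`. -/
def others (μ : Fin n → ℝ) (i : Fin n) : Multiset ℝ := (Finset.univ.erase i).val.map μ

theorem map_eq_cons_others (μ : Fin n → ℝ) (i : Fin n) :
    Finset.univ.val.map μ = μ i ::ₘ others μ i := by
  rw [others, ← Multiset.map_cons, Finset.erase_val, Multiset.cons_erase (Finset.mem_univ_val i)]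

theorem coeff_prod_others (μ : Fin n → ℝ) (i : Fin n) (l : ℕ) :
    (∏ j ∈ Finset.univ.erase i, (1 + C (μ j) * X : ℝ[X])).coeff l = (others μ i).esymm l := by
  rw [← coeff_prod_one_add, others, Multiset.map_map]; rfl

theorem coeff_X_mul_prod_others (μ : Fin n → ℝ) (i : Fin n) (l : ℕ) :
    (X * ∏ j ∈ Finset.univ.erase i, (1 + C (μ j) * X : ℝ[X])).coeff l =
      esymmPred (others μ i) l := by
  rcases l with _ | l
  · simp [esymmPred]
  · rw [coeff_X_mul, coeff_prod_others]; rfl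

/-- Euler's identity for the homogeneous polynomial S_l, read off from X times the derivative of the
generating polynomial. -/
theorem sum_mul_esymmPred (μ : Fin n → ℝ) (l : ℕ) :
    ∑ i, μ i * esymmPred (others μ i) l = l * (Finset.univ.val.map μ).esymm l := by
  have h : X * derivative (∏ i, (1 + C (μ i) * X : ℝ[X])) =
      ∑ i, C (μ i) * (X * ∏ j ∈ Finset.univ.erase i, (1 + C (μ j) * X : ℝ[X])) := by
    rw [derivative_prod_finset, Finset.mul_sum]
    refine Finset.sum_congr rfl fun i _ => ?_
    simp
    ring
  have h2 : (∏ i, (1 + C (μ i) * X : ℝ[X])) =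
      ((Finset.univ.val.map μ).map fun a => 1 + C a * X).prod := by
    rw [Multiset.map_map]; rfl
  have h3 := congrArg (fun p => coeff p l) h
  simp only [finsetSum_coeff, coeff_C_mul, coeff_X_mul_prod_others] at h3
  rw [← h3, h2]
  rcases l with _ | l
  · simp
  · rw [coeff_X_mul, coeff_derivative, coeff_prod_one_add]; push_cast; ring

/-- This is ellipticity of the linearized equation. -/
theorem cofactor_pos {k : ℕ} {μ : Fin n → ℝ} (hμ : InCone (k + 1) (Finset.univ.val.map μ))
    (he : (Finset.univ.val.map μ).esymm (k + 1) = (Finset.univ.val.map μ).esymm k)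
    (i : Fin n) : 0 < cofactor k (others μ i) := by
  have hS := hμ.esymm_pos (Nat.le_succ k)
  rw [map_eq_cons_others μ i] at hμ he hS
  have h1 := (inCone_of_cons hμ).esymm_pos le_rfl
  have h2 := sq_esymm_le_cofactor he
  have h3 : 0 < ((k : ℝ) + 1) * ((μ i ::ₘ others μ i).esymm k * cofactor k (others μ i)) :=
    lt_of_lt_of_le (by positivity) h2
  exact pos_of_mul_pos_right (pos_of_mul_pos_right h3 (by positivity)) hS.le

/-- By Euler the sum is (k+1)S_{k+1} − kS_k, which equals S_k on solutions. -/
theorem sum_cofactor_mul_pos {k : ℕ} {μ : Fin n → ℝ} (hμ : InCone (k + 1) (Finset.univ.val.map μ))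
    (he : (Finset.univ.val.map μ).esymm (k + 1) = (Finset.univ.val.map μ).esymm k) :
    0 < ∑ i, cofactor k (others μ i) * μ i := by
  have hS := hμ.esymm_pos (Nat.le_succ k)
  have h1 := sum_mul_esymmPred μ (k + 1)
  have h2 := sum_mul_esymmPred μ k
  have h3 : ∑ i, cofactor k (others μ i) * μ i = (Finset.univ.val.map μ).esymm k := by
    have : ∑ i, cofactor k (others μ i) * μ i =
        ∑ i, μ i * esymmPred (others μ i) (k + 1) - ∑ i, μ i * esymmPred (others μ i) k := by
      rw [← Finset.sum_sub_distrib]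
      exact Finset.sum_congr rfl fun i _ => by simp only [cofactor, esymmPred]; ring
    rw [this, h1, h2, he]; push_cast; ring
  rw [h3]; exact hS

theorem sum_cofactor_le {k : ℕ} {μ : Fin n → ℝ} (hμ : InCone (k + 1) (Finset.univ.val.map μ)) :
    ∑ i, cofactor k (others μ i) ≤ n * (Finset.univ.val.map μ).esymm k := by
  have hS := hμ.esymm_pos (Nat.le_succ k)
  have h2 := sum_mul_esymmPred μ k
  have h3 : ∀ i, cofactor k (others μ i) ≤
      (Finset.univ.val.map μ).esymm k - μ i * esymmPred (others μ i) k := fun i => by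
    have h4 : InCone k (others μ i) := inCone_of_cons (a := μ i) (by
      rw [← map_eq_cons_others]; exact hμ)
    have h5 := h4.esymmPred_nonneg
    rw [map_eq_cons_others μ i, esymm_cons, cofactor]
    linarith
  refine (Finset.sum_le_sum fun i _ => h3 i).trans ?_
  rw [Finset.sum_sub_distrib, h2]
  simp only [Finset.sum_const, Finset.card_univ, Fintype.card_fin, nsmul_eq_mul]
  have : 0 ≤ (k : ℝ) * (Finset.univ.val.map μ).esymm k := by positivity
  linarith

/-- Deleting a nonpositive entry does not decrease S_k, so `sq_esymm_le_cofactor` gives S_k ≤ (k +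
1)F_i, while the whole sum is at most n S_k. -/
theorem sum_cofactor_le_of_nonpos {k : ℕ} {μ : Fin n → ℝ} (hμ : InCone (k + 1) (Finset.univ.val.map μ))
    (he : (Finset.univ.val.map μ).esymm (k + 1) = (Finset.univ.val.map μ).esymm k)
    (i : Fin n) (hi : μ i ≤ 0) :
    ∑ j, cofactor k (others μ j) ≤ ((n : ℝ) + 1) * (k + 1) * cofactor k (others μ i) := by
  have h0 := sum_cofactor_le hμ
  have hS := hμ.esymm_pos (Nat.le_succ k)
  have hpos := cofactor_pos hμ he i
  refine h0.trans ?_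
  rw [map_eq_cons_others μ i] at hμ he hS ⊢
  have h5 := (inCone_of_cons hμ).esymmPred_nonneg
  have h2 := sq_esymm_le_cofactor he
  have h6 : (μ i ::ₘ others μ i).esymm k ≤ (others μ i).esymm k := by
    rw [esymm_cons]; nlinarith
  generalize (μ i ::ₘ others μ i).esymm k = S at *
  have h7 : S * S ≤ S * ((k + 1) * cofactor k (others μ i)) := by nlinarith
  have h8 := le_of_mul_le_mul_left h7 hS
  nlinarith [mul_le_mul_of_nonneg_left h8 (Nat.cast_nonneg (α := ℝ) n)]

end

end QkTranslator

/-! ### Adapted frames and the determinant form of the translator equation. -/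

namespace QkTranslator

section

open Polynomial Matrix
open scoped RealInnerProductSpace MatrixOrder

variable {n : ℕ}

theorem esymm_map_mul_left (c : ℝ) (s : Multiset ℝ) (l : ℕ) :
    (s.map fun a => c * a).esymm l = c ^ l * s.esymm l := by
  induction s using Multiset.induction_on generalizing l with
  | empty =>
    rcases l with _ | l
    · simp [esymm_zero_index]
    · rw [Multiset.map_zero, esymm_eq_zero_of_card_lt _ (by simp), mul_zero]
  | cons a s ih =>
    rcases l with _ | l
    · simp [esymm_zero_index]
    · rw [Multiset.map_cons, esymm_cons_succ, esymm_cons_succ, ih, ih]; ring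

/-- A positive definite and a symmetric real matrix are simultaneously diagonalizable by
congruence. -/
theorem exists_simultaneous_diagonalization {G H : Matrix (Fin n) (Fin n) ℝ} (hG : G.PosDef)
    (hH : Hᵀ = H) :
    ∃ (P : Matrix (Fin n) (Fin n) ℝ) (μ : Fin n → ℝ), Pᵀ * G * P = 1 ∧
      Pᵀ * H * P = diagonal μ := by
  obtain ⟨B, hB⟩ := CStarAlgebra.nonneg_iff_eq_star_mul_self.1 hG.posSemidef.nonneg
  rw [star_eq_conjTranspose, conjTranspose_eq_transpose_of_trivial] at hB
  have hBu : IsUnit B.det := by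
    have h := hG.det_pos
    rw [hB, det_mul] at h
    exact isUnit_iff_ne_zero.2 (right_ne_zero_of_mul h.ne')
  have hS : ((B⁻¹)ᵀ * H * B⁻¹).IsHermitian := by
    rw [IsHermitian, conjTranspose_eq_transpose_of_trivial]
    simp only [transpose_mul, transpose_transpose, hH, Matrix.mul_assoc]
  set U : Matrix (Fin n) (Fin n) ℝ := hS.eigenvectorUnitary.1
  have hUU : Uᵀ * U = 1 := by
    have := Unitary.coe_star_mul_self hS.eigenvectorUnitary
    rwa [star_eq_conjTranspose, conjTranspose_eq_transpose_of_trivial] at this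
  have hUD : Uᵀ * ((B⁻¹)ᵀ * H * B⁻¹) * U = diagonal hS.eigenvalues := by
    have := hS.conjStarAlgAut_star_eigenvectorUnitary
    rw [Unitary.conjStarAlgAut_star_apply, star_eq_conjTranspose,
      conjTranspose_eq_transpose_of_trivial] at this
    simpa [Function.comp_def] using this
  refine ⟨B⁻¹ * U, hS.eigenvalues, ?_, ?_⟩
  · calc (B⁻¹ * U)ᵀ * G * (B⁻¹ * U) = Uᵀ * ((B * B⁻¹)ᵀ * (B * B⁻¹)) * U := by
          rw [hB]; simp only [transpose_mul, Matrix.mul_assoc]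
      _ = 1 := by rw [mul_nonsing_inv _ hBu]; simpa using hUU
  · rw [← hUD]
    simp only [transpose_mul, Matrix.mul_assoc]

variable {u : EuclideanSpace ℝ (Fin n) → ℝ} {x : EuclideanSpace ℝ (Fin n)}

theorem inner_gradient (v : EuclideanSpace ℝ (Fin n)) : ⟪gradient u x, v⟫ = fderiv ℝ u x v := by
  simp [gradient]

theorem fderiv_eq_sum (v : EuclideanSpace ℝ (Fin n)) :
    fderiv ℝ u x v = ∑ i, v i * gradient u x i := by
  rw [← inner_gradient, PiLp.inner_apply]
  rfl

theorem firstFundamentalForm_eq : firstFundamentalForm u x =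
    1 + vecMulVec (WithLp.ofLp (gradient u x)) (WithLp.ofLp (gradient u x)) := by
  ext i j
  simp [firstFundamentalForm, vecMulVec_apply, Matrix.one_apply]

theorem posDef_firstFundamentalForm : (firstFundamentalForm u x).PosDef := by
  rw [firstFundamentalForm_eq]
  refine PosDef.one.add_posSemidef ?_
  simpa using posSemidef_vecMulVec_self_star (WithLp.ofLp (gradient u x))

theorem areaElement_pos : 0 < areaElement u x := Real.sqrt_pos.2 (by positivity)

/-- The matrix whose columns are the vectors `e a`. -/
def columns (e : Fin n → EuclideanSpace ℝ (Fin n)) : Matrix (Fin n) (Fin n) ℝ :=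
  Matrix.of fun i a => e a i

theorem congr_first (e : Fin n → EuclideanSpace ℝ (Fin n)) :
    (columns e)ᵀ * firstFundamentalForm u x * columns e =
      Matrix.of fun a b => ⟪e a, e b⟫ + fderiv ℝ u x (e a) * fderiv ℝ u x (e b) := by
  ext a b
  rw [firstFundamentalForm_eq, Matrix.mul_add, Matrix.add_mul, Matrix.mul_one, Matrix.add_apply]
  congr 1
  · simp [Matrix.mul_apply, columns, PiLp.inner_apply, mul_comm]
  · rw [mul_vecMulVec, vecMulVec_mul, vecMulVec_apply, fderiv_eq_sum, fderiv_eq_sum]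
    simp [mulVec, vecMul, dotProduct, columns, mul_comm]

theorem congr_hessian (e : Fin n → EuclideanSpace ℝ (Fin n)) :
    (columns e)ᵀ * hessian u x * columns e =
      Matrix.of fun a b => fderiv ℝ (fderiv ℝ u) x (e a) (e b) := by
  ext a b
  have h : ∀ v : EuclideanSpace ℝ (Fin n), v = ∑ i, v i • EuclideanSpace.single i (1 : ℝ) := by
    intro v
    have := (EuclideanSpace.basisFun (Fin n) ℝ).sum_repr v
    simpa using this.symm
  conv_rhs => rw [Matrix.of_apply, h (e a), h (e b)]
  simp only [map_sum, map_smul, _root_.sum_apply, _root_.smul_apply,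
    Matrix.mul_apply, columns, hessian, transpose_apply, Matrix.of_apply, smul_eq_mul,
    Finset.sum_mul, Finset.mul_sum]
  refine Finset.sum_congr rfl fun i _ => Finset.sum_congr rfl fun j _ => ?_
  ring

/-- `e` is orthonormal for the metric of the graph of `u` at `x` and diagonalizes the Hessian, with
diagonal entries `μ`. -/
structure IsFrame (u : EuclideanSpace ℝ (Fin n) → ℝ) (x : EuclideanSpace ℝ (Fin n))
    (e : Fin n → EuclideanSpace ℝ (Fin n)) (μ : Fin n → ℝ) : Prop where
  metric : ∀ a b, ⟪e a, e b⟫ + fderiv ℝ u x (e a) * fderiv ℝ u x (e b) = if a = b then 1 else 0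
  hess : ∀ a b, fderiv ℝ (fderiv ℝ u) x (e a) (e b) = if a = b then μ a else 0

theorem isFrame_iff {e : Fin n → EuclideanSpace ℝ (Fin n)} {μ : Fin n → ℝ} :
    IsFrame u x e μ ↔ (columns e)ᵀ * firstFundamentalForm u x * columns e = 1 ∧
      (columns e)ᵀ * hessian u x * columns e = diagonal μ := by
  rw [congr_first, congr_hessian, ← Matrix.ext_iff, ← Matrix.ext_iff]
  simp only [Matrix.of_apply, Matrix.one_apply, Matrix.diagonal_apply]
  exact ⟨fun h => ⟨h.1, h.2⟩, fun h => ⟨h.1, h.2⟩⟩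

theorem fderiv_fderiv_symm (hu : ContDiffAt ℝ 3 u x) (v w : EuclideanSpace ℝ (Fin n)) :
    fderiv ℝ (fderiv ℝ u) x v w = fderiv ℝ (fderiv ℝ u) x w v :=
  hu.isSymmSndFDerivAt (by rw [minSmoothness_of_isRCLikeNormedField]; norm_num) v w

theorem exists_isFrame (hu : ContDiffAt ℝ 3 u x) : ∃ e μ, IsFrame u x e μ := by
  obtain ⟨P, μ, h1, h2⟩ := exists_simultaneous_diagonalization
    (posDef_firstFundamentalForm (u := u) (x := x)) (H := hessian u x)
    (by ext i j; exact fderiv_fderiv_symm hu _ _)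
  refine ⟨fun a => WithLp.toLp 2 fun i => P i a, μ, isFrame_iff.2 ⟨?_, ?_⟩⟩
  · exact h1
  · exact h2

section Frame

variable {e : Fin n → EuclideanSpace ℝ (Fin n)} {μ : Fin n → ℝ}

theorem IsFrame.principalCurvatures_eq (h : IsFrame u x e μ) :
    principalCurvatures u x = (Finset.univ.val.map μ).map fun a => (areaElement u x)⁻¹ * a := by
  obtain ⟨h1, h2⟩ := isFrame_iff.1 h
  set P := columns e
  have hg : (firstFundamentalForm u x)⁻¹ = P * Pᵀ := by
    refine Matrix.inv_eq_left_inv ?_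
    rw [Matrix.mul_assoc]
    exact mul_eq_one_comm.1 h1
  have hc : (weingarten u x).charpoly =
      (diagonal fun i => (areaElement u x)⁻¹ * μ i).charpoly := by
    rw [weingarten, hg, Matrix.mul_assoc, charpoly_mul_comm, secondFundamentalForm,
      Matrix.mul_smul, Matrix.smul_mul, h2, ← diagonal_smul]
    rfl
  rw [principalCurvatures, hc, charpoly_diagonal, Polynomial.roots_prod _ _
    (Finset.prod_ne_zero_iff.2 fun i _ => X_sub_C_ne_zero _)]
  simp only [roots_X_sub_C, Multiset.bind_singleton, Multiset.map_map, Function.comp_def]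

theorem IsFrame.inCone {m : ℕ} (h : IsFrame u x e μ) (hc : InCone m (principalCurvatures u x)) :
    InCone m (Finset.univ.val.map μ) := by
  intro l h1 h2
  have := hc l h1 h2
  rw [h.principalCurvatures_eq, esymm_map_mul_left] at this
  exact pos_of_mul_pos_right this (pow_nonneg (inv_nonneg.2 areaElement_pos.le) _)

/-- The curvatures are μ/w and Q_k has degree one, so w cancels from both sides. -/
theorem IsFrame.esymm_eq {k : ℕ} (h : IsFrame u x e μ)
    (hc : InCone (k + 1) (principalCurvatures u x))
    (hQ : Q k (principalCurvatures u x) = 1 / areaElement u x) :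
    (Finset.univ.val.map μ).esymm (k + 1) = (Finset.univ.val.map μ).esymm k := by
  have h0 := (h.inCone hc).esymm_pos (Nat.le_succ k)
  have hw := areaElement_pos (u := u) (x := x)
  rw [Q, h.principalCurvatures_eq, esymm_map_mul_left, esymm_map_mul_left] at hQ
  rw [div_eq_div_iff (by positivity) hw.ne', pow_succ] at hQ
  have h2 : ((areaElement u x)⁻¹) ^ k ≠ 0 := by positivity
  refine mul_left_cancel₀ h2 ?_
  field_simp at hQ ⊢
  linarith

end Frame

/-- The pencil `g + X D²u` in terms of the vectors `e a`. -/
noncomputable def pencil (u : EuclideanSpace ℝ (Fin n) → ℝ) (e : Fin n → EuclideanSpace ℝ (Fin n))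
    (x : EuclideanSpace ℝ (Fin n)) : Matrix (Fin n) (Fin n) ℝ[X] :=
  Matrix.of fun a b => C (⟪e a, e b⟫ + fderiv ℝ u x (e a) * fderiv ℝ u x (e b)) +
    C (fderiv ℝ (fderiv ℝ u) x (e a) (e b)) * X

theorem det_pencil (e : Fin n → EuclideanSpace ℝ (Fin n)) : (pencil u e x).det =
    C ((columns e).det ^ 2) * ((firstFundamentalForm u x).map C +
      (X : ℝ[X]) • (hessian u x).map C).det := by
  have h : pencil u e x = ((columns e).map C)ᵀ * ((firstFundamentalForm u x).map C +
      (X : ℝ[X]) • (hessian u x).map C) * (columns e).map C := by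
    rw [Matrix.mul_add, Matrix.add_mul, Matrix.mul_smul, Matrix.smul_mul, ← transpose_map,
      ← Matrix.map_mul, ← Matrix.map_mul, ← Matrix.map_mul, ← Matrix.map_mul, congr_first,
      congr_hessian]
    ext1 a b
    simp [pencil]
  have h2 : ((columns e).map C).det = (C (columns e).det : ℝ[X]) := by
    rw [RingHom.map_det]; rfl
  rw [h, det_mul, det_mul, det_transpose, h2, C_pow]
  ring

theorem IsFrame.pencil_eq {e : Fin n → EuclideanSpace ℝ (Fin n)} {μ : Fin n → ℝ}
    (h : IsFrame u x e μ) : pencil u e x = diagonal fun i => 1 + C (μ i) * X := by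
  ext1 a b
  rw [pencil, Matrix.of_apply, h.metric, h.hess, diagonal_apply]
  split_ifs <;> simp

/-- A change of vectors multiplies the determinant by a constant, so the equation holds for
arbitrary e. It can thus be differentiated in x with e fixed, without differentiating eigenvalues or
frames. -/
theorem coeff_det_pencil {k : ℕ} (hu : ContDiffAt ℝ 3 u x)
    (hc : InCone (k + 1) (principalCurvatures u x))
    (hQ : Q k (principalCurvatures u x) = 1 / areaElement u x)
    (e : Fin n → EuclideanSpace ℝ (Fin n)) :
    (pencil u e x).det.coeff (k + 1) = (pencil u e x).det.coeff k := by
  obtain ⟨f, μ, hf⟩ := exists_isFrame hu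
  have h1 := det_pencil (u := u) (x := x) f
  have hd : (columns f).det ≠ 0 := by
    have := congrArg Matrix.det (isFrame_iff.1 hf).1
    rw [det_mul, det_one] at this
    exact right_ne_zero_of_mul (this.trans_ne one_ne_zero)
  have h2 : (pencil u f x).det = ((Finset.univ.val.map μ).map fun a => 1 + C a * X).prod := by
    rw [hf.pencil_eq, det_diagonal, Multiset.map_map]; rfl
  have h3 := hf.esymm_eq hc hQ
  rw [← coeff_prod_one_add, ← coeff_prod_one_add, ← h2, h1, coeff_C_mul, coeff_C_mul] at h3
  rw [det_pencil, coeff_C_mul, coeff_C_mul, mul_left_cancel₀ (pow_ne_zero 2 hd) h3]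

end

end QkTranslator

/-! ### Differentiating the translator equation. -/

namespace QkTranslator

section

open Polynomial Matrix Filter Topology
open scoped RealInnerProductSpace MatrixOrder

variable {n : ℕ}

/-- Coefficientwise differentiability of a curve of polynomials. -/
def HasCoeffDerivAt (p : ℝ → ℝ[X]) (p' : ℝ[X]) (t : ℝ) : Prop :=
  ∀ l, HasDerivAt (fun s => (p s).coeff l) (p'.coeff l) t

theorem HasCoeffDerivAt.const (c : ℝ[X]) (t : ℝ) : HasCoeffDerivAt (fun _ => c) 0 t :=
  fun l => by simpa using hasDerivAt_const t (c.coeff l)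

theorem HasCoeffDerivAt.mul {p q : ℝ → ℝ[X]} {p' q' : ℝ[X]} {t : ℝ} (hp : HasCoeffDerivAt p p' t)
    (hq : HasCoeffDerivAt q q' t) :
    HasCoeffDerivAt (fun s => p s * q s) (p' * q t + p t * q') t := fun l => by
  simp only [coeff_mul, coeff_add]
  rw [← Finset.sum_add_distrib]
  exact HasDerivAt.fun_sum fun i _ => (hp i.1).mul (hq i.2)

theorem HasCoeffDerivAt.sum {ι : Type*} {p : ι → ℝ → ℝ[X]} {p' : ι → ℝ[X]} {t : ℝ} (s : Finset ι)
    (h : ∀ i ∈ s, HasCoeffDerivAt (p i) (p' i) t) :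
    HasCoeffDerivAt (fun r => ∑ i ∈ s, p i r) (∑ i ∈ s, p' i) t := fun l => by
  simp only [finsetSum_coeff]
  exact HasDerivAt.fun_sum fun i hi => h i hi l

theorem HasCoeffDerivAt.prod {ι : Type*} [DecidableEq ι] {p : ι → ℝ → ℝ[X]} {p' : ι → ℝ[X]}
    {t : ℝ} (s : Finset ι) (h : ∀ i ∈ s, HasCoeffDerivAt (p i) (p' i) t) :
    HasCoeffDerivAt (fun r => ∏ i ∈ s, p i r) (∑ i ∈ s, (∏ j ∈ s.erase i, p j t) * p' i) t := by
  induction s using Finset.induction_on with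
  | empty => simpa using HasCoeffDerivAt.const 1 t
  | insert a s ha ih =>
    have h1 := (h a (Finset.mem_insert_self a s)).mul
      (ih fun i hi => h i (Finset.mem_insert_of_mem hi))
    have h2 : ∑ i ∈ insert a s, (∏ j ∈ (insert a s).erase i, p j t) * p' i =
        p' a * ∏ i ∈ s, p i t + p a t * ∑ i ∈ s, (∏ j ∈ s.erase i, p j t) * p' i := by
      rw [Finset.sum_insert ha, Finset.erase_insert ha, Finset.mul_sum, mul_comm (p' a)]
      congr 1
      refine Finset.sum_congr rfl fun i hi => ?_
      rw [Finset.erase_insert_of_ne (by rintro rfl; exact ha hi),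
        Finset.prod_insert (fun hai => ha (Finset.mem_of_mem_erase hai)), mul_assoc]
    simp only [Finset.prod_insert ha]
    rw [h2]
    exact h1

/-- Jacobi's formula at a diagonal matrix. -/
theorem HasCoeffDerivAt.det {A : ℝ → Matrix (Fin n) (Fin n) ℝ[X]} {A' : Matrix (Fin n) (Fin n) ℝ[X]}
    {t : ℝ} {d : Fin n → ℝ[X]} (hd : A t = diagonal d)
    (h : ∀ i j, HasCoeffDerivAt (fun s => A s i j) (A' i j) t) :
    HasCoeffDerivAt (fun s => (A s).det) (∑ i, (∏ j ∈ Finset.univ.erase i, d j) * A' i i) t := by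
  have h1 : HasCoeffDerivAt (fun s => (A s).det)
      (∑ σ : Equiv.Perm (Fin n), (0 * ∏ i, A t (σ i) i + (((Equiv.Perm.sign σ : ℤ) : ℝ[X])) *
        ∑ i, (∏ j ∈ Finset.univ.erase i, A t (σ j) j) * A' (σ i) i)) t := by
    simp only [det_apply']
    exact HasCoeffDerivAt.sum _ fun σ _ => (HasCoeffDerivAt.const _ t).mul
      (HasCoeffDerivAt.prod _ fun i _ => h _ _)
  have h2 : ∑ i, (∏ j ∈ Finset.univ.erase i, d j) * A' i i =
      ∑ σ : Equiv.Perm (Fin n), (0 * ∏ i, A t (σ i) i + (((Equiv.Perm.sign σ : ℤ) : ℝ[X])) *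
        ∑ i, (∏ j ∈ Finset.univ.erase i, A t (σ j) j) * A' (σ i) i) := ?_
  · rw [h2]; exact h1
  rw [Finset.sum_eq_single (1 : Equiv.Perm (Fin n))]
  · simp [hd]
  · intro σ _ hσ
    rw [zero_mul, zero_add]
    refine mul_eq_zero_of_right _ (Finset.sum_eq_zero fun i _ => mul_eq_zero_of_left ?_ _)
    -- A nontrivial permutation moves at least two indices, so an off-diagonal zero survives the
    -- removal of factor i.
    have : ∃ j, j ≠ i ∧ σ j ≠ j := by
      by_contra! hc
      refine hσ (Equiv.ext fun j => ?_)
      rcases eq_or_ne j i with rfl | hj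
      · by_contra hne
        rw [Equiv.Perm.one_apply] at hne
        exact hne (σ.injective (hc _ hne))
      · exact hc j hj
    obtain ⟨j, hj, hσj⟩ := this
    refine Finset.prod_eq_zero (Finset.mem_erase.2 ⟨hj, Finset.mem_univ j⟩) ?_
    rw [hd, diagonal_apply_ne _ hσj]
  · simp

variable {u : EuclideanSpace ℝ (Fin n) → ℝ} {x : EuclideanSpace ℝ (Fin n)}

theorem hasDerivAt_along {F : Type*} [NormedAddCommGroup F] [NormedSpace ℝ F]
    {f : EuclideanSpace ℝ (Fin n) → F} {v : EuclideanSpace ℝ (Fin n)} {t : ℝ}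
    (hf : DifferentiableAt ℝ f (x + t • v)) :
    HasDerivAt (fun s : ℝ => f (x + s • v)) (fderiv ℝ f (x + t • v) v) t := by
  have h : HasDerivAt (fun s : ℝ => x + s • v) v t := by
    simpa using ((hasDerivAt_id t).smul_const v).const_add x
  exact hf.hasFDerivAt.comp_hasDerivAt t h

theorem contDiffAt_fderiv (hu : ContDiffAt ℝ 3 u x) : ContDiffAt ℝ 2 (fderiv ℝ u) x :=
  hu.fderiv_right (by norm_num)

theorem contDiffAt_fderiv_fderiv (hu : ContDiffAt ℝ 3 u x) :
    ContDiffAt ℝ 1 (fderiv ℝ (fderiv ℝ u)) x :=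
  (contDiffAt_fderiv hu).fderiv_right (by norm_num)

/-- The first two slots commute as the second derivative of Du. The last two commute because D²u is
symmetric at all nearby points of a line and this can be differentiated. -/
theorem thirdDeriv_symm (hu : ContDiffAt ℝ 3 u x) (a c : EuclideanSpace ℝ (Fin n)) :
    fderiv ℝ (fderiv ℝ (fderiv ℝ u)) x a a c = fderiv ℝ (fderiv ℝ (fderiv ℝ u)) x c a a := by
  have h1 : fderiv ℝ (fderiv ℝ (fderiv ℝ u)) x a c = fderiv ℝ (fderiv ℝ (fderiv ℝ u)) x c a :=
    (contDiffAt_fderiv hu).isSymmSndFDerivAt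
      (by rw [minSmoothness_of_isRCLikeNormedField]) a c
  rw [← h1]
  have hd : HasFDerivAt (fderiv ℝ (fderiv ℝ u)) (fderiv ℝ (fderiv ℝ (fderiv ℝ u)) x) x :=
    ((contDiffAt_fderiv_fderiv hu).differentiableAt (by norm_num)).hasFDerivAt
  have hline : HasDerivAt (fun s : ℝ => fderiv ℝ (fderiv ℝ u) (x + s • a))
      (fderiv ℝ (fderiv ℝ (fderiv ℝ u)) x a) 0 := by
    have := hasDerivAt_along (x := x) (v := a) (t := 0) (f := fderiv ℝ (fderiv ℝ u))
      (by simpa using hd.differentiableAt)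
    simpa using this
  have hac := (hline.clm_apply (hasDerivAt_const 0 a)).clm_apply (hasDerivAt_const 0 c)
  have hca := (hline.clm_apply (hasDerivAt_const 0 c)).clm_apply (hasDerivAt_const 0 a)
  simp only [map_zero, add_zero] at hac hca
  have hcont : Tendsto (fun s : ℝ => x + s • a) (𝓝 0) (𝓝 x) := by
    have : Continuous fun s : ℝ => x + s • a := by fun_prop
    simpa using this.tendsto 0
  have hev : (fun s : ℝ => fderiv ℝ (fderiv ℝ u) (x + s • a) a c) =ᶠ[𝓝 0]
      fun s => fderiv ℝ (fderiv ℝ u) (x + s • a) c a := by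
    filter_upwards [hcont.eventually (hu.eventually (by norm_num))] with s hs
    exact fderiv_fderiv_symm hs a c
  exact hac.unique (hca.congr_of_eventuallyEq hev)

section Frame

variable {e : Fin n → EuclideanSpace ℝ (Fin n)} {μ : Fin n → ℝ}

theorem IsFrame.expand (h : IsFrame u x e μ) (v : EuclideanSpace ℝ (Fin n)) :
    v = ∑ j, (⟪e j, v⟫ + fderiv ℝ u x (e j) * fderiv ℝ u x v) • e j := by
  have h1 := mul_eq_one_comm.1 (isFrame_iff.1 h).1
  have hj : ∀ j, (((columns e)ᵀ * firstFundamentalForm u x) *ᵥ (WithLp.ofLp v)) j =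
      ⟪e j, v⟫ + fderiv ℝ u x (e j) * fderiv ℝ u x v := by
    intro j
    rw [firstFundamentalForm_eq, Matrix.mul_add, Matrix.mul_one, Matrix.add_mulVec, Pi.add_apply]
    congr 1
    · simp [mulVec, dotProduct, columns, PiLp.inner_apply, mul_comm]
    · rw [mul_vecMulVec, vecMulVec_mulVec, fderiv_eq_sum, fderiv_eq_sum]
      simp [mulVec, dotProduct, columns, mul_comm]
  have h2 : columns e *ᵥ (((columns e)ᵀ * firstFundamentalForm u x) *ᵥ (WithLp.ofLp v)) =
      WithLp.ofLp v := by
    rw [mulVec_mulVec, h1, one_mulVec]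
  ext i
  have h3 := congrFun h2 i
  rw [← h3, mulVec, dotProduct]
  simp only [hj]
  simp [columns, mul_comm]

theorem IsFrame.hess_apply (h : IsFrame u x e μ) (i : Fin n) (v : EuclideanSpace ℝ (Fin n)) :
    fderiv ℝ (fderiv ℝ u) x (e i) v =
      μ i * (⟪e i, v⟫ + fderiv ℝ u x (e i) * fderiv ℝ u x v) := by
  conv_lhs => rw [h.expand v]
  simp only [map_sum, map_smul, h.hess, smul_eq_mul]
  rw [Finset.sum_eq_single i]
  · simp [mul_comm]
  · intro j _ hj; simp [hj.symm]
  · simp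

theorem fderiv_gradient : fderiv ℝ u x (gradient u x) = ‖gradient u x‖ ^ 2 := by
  rw [← inner_gradient, real_inner_self_eq_norm_sq]

theorem inner_gradient_right (v : EuclideanSpace ℝ (Fin n)) :
    ⟪v, gradient u x⟫ = fderiv ℝ u x v := by
  rw [real_inner_comm, inner_gradient]

theorem IsFrame.hess_gradient (h : IsFrame u x e μ) (i : Fin n) :
    fderiv ℝ (fderiv ℝ u) x (e i) (gradient u x) =
      μ i * fderiv ℝ u x (e i) * (1 + ‖gradient u x‖ ^ 2) := by
  rw [h.hess_apply, fderiv_gradient, inner_gradient_right]; ring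

theorem IsFrame.gradient_eq (h : IsFrame u x e μ) :
    gradient u x = (1 + ‖gradient u x‖ ^ 2) • ∑ j, fderiv ℝ u x (e j) • e j := by
  conv_lhs => rw [h.expand (gradient u x)]
  rw [Finset.smul_sum]
  refine Finset.sum_congr rfl fun j _ => ?_
  rw [fderiv_gradient, inner_gradient_right, smul_smul]
  congr 1; ring

theorem IsFrame.sum_sq (h : IsFrame u x e μ) :
    (1 + ‖gradient u x‖ ^ 2) * ∑ j, fderiv ℝ u x (e j) ^ 2 = ‖gradient u x‖ ^ 2 := by
  conv_rhs => rw [← fderiv_gradient, h.gradient_eq]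
  simp only [map_smul, map_sum, smul_eq_mul, sq]

theorem IsFrame.norm_sq_le (h : IsFrame u x e μ) (i : Fin n) : ‖e i‖ ^ 2 ≤ 1 := by
  have := h.metric i i
  rw [if_pos rfl, real_inner_self_eq_norm_sq] at this
  nlinarith [mul_self_nonneg (fderiv ℝ u x (e i))]

theorem IsFrame.hess_dual (h : IsFrame u x e μ) (i : Fin n) :
    fderiv ℝ (fderiv ℝ u) x (e i)
      ((InnerProductSpace.toDual ℝ _).symm (fderiv ℝ (fderiv ℝ u) x (e i))) =
      μ i ^ 2 * (1 + fderiv ℝ u x (e i) ^ 2 * (1 + ‖gradient u x‖ ^ 2)) := by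
  rw [h.hess_apply, ← inner_gradient ((InnerProductSpace.toDual ℝ _).symm _),
    real_inner_comm _ (e i), real_inner_comm _ (gradient u x),
    InnerProductSpace.toDual_symm_apply, InnerProductSpace.toDual_symm_apply, h.hess_gradient,
    h.hess, if_pos rfl]
  ring

/-- The differentiated translator equation. -/
theorem IsFrame.sum_thirdDeriv (h : IsFrame u x e μ) {k : ℕ}
    (hu : ∀ᶠ y in 𝓝 x, ContDiffAt ℝ 3 u y ∧ InCone (k + 1) (principalCurvatures u y) ∧
      Q k (principalCurvatures u y) = 1 / areaElement u y) (v : EuclideanSpace ℝ (Fin n)) :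
    ∑ i, cofactor k (others μ i) * (fderiv ℝ (fderiv ℝ (fderiv ℝ u)) x v (e i) (e i) -
      2 * μ i * fderiv ℝ u x (e i) * fderiv ℝ (fderiv ℝ u) x v (e i)) = 0 := by
  obtain ⟨hx, hc, hQ⟩ := hu.self_of_nhds
  have he := h.esymm_eq hc hQ
  have hL : HasDerivAt (fun s : ℝ => fderiv ℝ u (x + s • v)) (fderiv ℝ (fderiv ℝ u) x v) 0 := by
    have := hasDerivAt_along (x := x) (v := v) (t := 0) (f := fderiv ℝ u)
      (by simpa using (contDiffAt_fderiv hx).differentiableAt (by norm_num))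
    simpa using this
  have hB : HasDerivAt (fun s : ℝ => fderiv ℝ (fderiv ℝ u) (x + s • v))
      (fderiv ℝ (fderiv ℝ (fderiv ℝ u)) x v) 0 := by
    have := hasDerivAt_along (x := x) (v := v) (t := 0) (f := fderiv ℝ (fderiv ℝ u))
      (by simpa using (contDiffAt_fderiv_fderiv hx).differentiableAt (by norm_num))
    simpa using this
  set α : Fin n → Fin n → ℝ := fun a b => fderiv ℝ (fderiv ℝ u) x v (e a) * fderiv ℝ u x (e b) +
    fderiv ℝ u x (e a) * fderiv ℝ (fderiv ℝ u) x v (e b) with hα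
  set β : Fin n → Fin n → ℝ := fun a b =>
    fderiv ℝ (fderiv ℝ (fderiv ℝ u)) x v (e a) (e b) with hβ
  have hentry : ∀ a b, HasCoeffDerivAt (fun s : ℝ => pencil u e (x + s • v) a b)
      (C (α a b) + C (β a b) * X) 0 := by
    intro a b l
    have h1 : HasDerivAt (fun s : ℝ => ⟪e a, e b⟫ +
        fderiv ℝ u (x + s • v) (e a) * fderiv ℝ u (x + s • v) (e b)) (α a b) 0 := by
      have := ((hL.clm_apply (hasDerivAt_const 0 (e a))).mul
        (hL.clm_apply (hasDerivAt_const 0 (e b)))).const_add ⟪e a, e b⟫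
      simpa [hα] using this
    have h2 : HasDerivAt (fun s : ℝ => fderiv ℝ (fderiv ℝ u) (x + s • v) (e a) (e b))
        (β a b) 0 := by
      have := (hB.clm_apply (hasDerivAt_const 0 (e a))).clm_apply (hasDerivAt_const 0 (e b))
      simpa [hβ] using this
    simp only [pencil, Matrix.of_apply, coeff_add, coeff_C, coeff_C_mul]
    refine HasDerivAt.add ?_ (h2.mul_const _)
    split_ifs
    · exact h1
    · exact hasDerivAt_const _ _
  have hdet := HasCoeffDerivAt.det (A := fun s : ℝ => pencil u e (x + s • v)) (t := 0)
    (A' := Matrix.of fun a b => C (α a b) + C (β a b) * X)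
    (d := fun i => 1 + C (μ i) * X) (by simpa using h.pencil_eq)
    (fun i j => by rw [Matrix.of_apply]; exact hentry i j)
  have hcont : Tendsto (fun s : ℝ => x + s • v) (𝓝 0) (𝓝 x) := by
    have : Continuous fun s : ℝ => x + s • v := by fun_prop
    simpa using this.tendsto 0
  have hev : (fun s : ℝ => (pencil u e (x + s • v)).det.coeff (k + 1)) =ᶠ[𝓝 0]
      fun s => (pencil u e (x + s • v)).det.coeff k := by
    filter_upwards [hcont.eventually hu] with s hs
    exact coeff_det_pencil hs.1 hs.2.1 hs.2.2 e
  have hEq := (hdet (k + 1)).unique ((hdet k).congr_of_eventuallyEq hev)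
  have hcoeff : ∀ l, (∑ i, (∏ j ∈ Finset.univ.erase i, (1 + C (μ j) * X)) *
      (Matrix.of fun a b => C (α a b) + C (β a b) * X) i i : ℝ[X]).coeff l =
      ∑ i, (α i i * (others μ i).esymm l + β i i * esymmPred (others μ i) l) := by
    intro l
    rw [finsetSum_coeff]
    refine Finset.sum_congr rfl fun i _ => ?_
    rw [Matrix.of_apply, mul_add, coeff_add, mul_comm _ (C _), coeff_C_mul, coeff_prod_others,
      mul_comm _ (C _ * X), mul_assoc, coeff_C_mul, coeff_X_mul_prod_others]
  rw [hcoeff, hcoeff, ← sub_eq_zero, ← Finset.sum_sub_distrib] at hEq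
  rw [← hEq]
  refine Finset.sum_congr rfl fun i _ => ?_
  -- The equation gives S_{k+1} − S_k = −μ_i F_i on the other entries, which turns the contribution
  -- of the moving metric into the term −2 μ_i p_i.
  rw [map_eq_cons_others μ i, esymm_cons, esymm_cons] at he
  simp only [hα, hβ, cofactor, esymmPred] at he ⊢
  linear_combination (-2 * fderiv ℝ u x (e i) * fderiv ℝ (fderiv ℝ u) x v (e i)) * he

end Frame
end

end QkTranslator

/-! ### The maximum principle for the barrier. -/

namespace QkTranslator

section

open Filter Topology
open scoped RealInnerProductSpace

variable {n : ℕ}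

/-- The second-order necessary condition for a local maximum. -/
theorem second_derivative_nonpos_of_isLocalMax {f f' : ℝ → ℝ} {a t : ℝ}
    (hf : ∀ᶠ s in 𝓝 t, HasDerivAt f (f' s) s) (hf' : HasDerivAt f' a t) (hmax : IsLocalMax f t) :
    f' t = 0 ∧ a ≤ 0 := by
  have h0 : f' t = 0 := hmax.hasDerivAt_eq_zero hf.self_of_nhds
  refine ⟨h0, ?_⟩
  by_contra! ha
  have hev : deriv f =ᶠ[𝓝 t] f' := hf.mono fun s hs => hs.deriv
  have hdd : deriv (deriv f) t = a := by rw [hev.deriv_eq]; exact hf'.deriv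
  have hmin : IsLocalMin f t := isLocalMin_of_deriv_deriv_pos (by rw [hdd]; exact ha)
    (by rw [hev.self_of_nhds, h0]) hf.self_of_nhds.continuousAt
  have hconst : f =ᶠ[𝓝 t] fun _ => f t := by
    filter_upwards [hmax, hmin] with s h1 h2
    exact le_antisymm h1 h2
  have hd : deriv f =ᶠ[𝓝 t] fun _ => 0 := by
    filter_upwards [hconst.eventuallyEq_nhds] with s hs
    rw [hs.deriv_eq]; simp
  have : deriv (deriv f) t = 0 := by rw [hd.deriv_eq]; simp
  linarith

/-- Both derivative tests for the logarithm of the barrier, multiplied by c = 1 − e^{−h}. With ω =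
w'/(2w), the coefficient 3 is 2 from (log w)''/2 plus 1 from the term −(h')²/c, which is −cω² by the
first-order condition. -/
theorem barrier_max {h h₁ w w₁ : ℝ → ℝ} {h₂ w₂ : ℝ}
    (hh : ∀ᶠ s in 𝓝 0, HasDerivAt h (h₁ s) s) (hh₁ : HasDerivAt h₁ h₂ 0)
    (hw : ∀ᶠ s in 𝓝 0, HasDerivAt w (w₁ s) s) (hw₁ : HasDerivAt w₁ w₂ 0)
    (hpos : 0 < h 0) (hwpos : ∀ s, 0 < w s)
    (hmax : IsLocalMax (fun s => Real.log (Real.exp (h s) - 1) + Real.log (w s) / 2) 0) :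
    h₁ 0 = -(1 - Real.exp (-h 0)) * (w₁ 0 / (2 * w 0)) ∧
      h₂ + h₁ 0 ^ 2 +
        (1 - Real.exp (-h 0)) * (w₂ / (2 * w 0) - 3 * (w₁ 0 / (2 * w 0)) ^ 2) ≤ 0 := by
  have hcont : ContinuousAt h 0 := hh.self_of_nhds.continuousAt
  have hposev : ∀ᶠ s in 𝓝 0, 0 < h s := hcont.eventually (lt_mem_nhds hpos)
  have hE : ∀ s, 0 < h s → 0 < Real.exp (h s) - 1 := fun s hs => by
    have := Real.add_one_lt_exp hs.ne'
    linarith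
  have h1 : ∀ᶠ s in 𝓝 0, HasDerivAt (fun s => Real.log (Real.exp (h s) - 1) + Real.log (w s) / 2)
      (Real.exp (h s) * h₁ s / (Real.exp (h s) - 1) + w₁ s / w s / 2) s := by
    filter_upwards [hh, hw, hposev] with s hs ws ps
    exact ((hs.exp.sub_const 1).log (hE s ps).ne').add ((ws.log (hwpos s).ne').div_const 2)
  have e0 := (hE 0 hpos).ne'
  have w0 := (hwpos 0).ne'
  have h2 := (((hh.self_of_nhds.exp.mul hh₁).div (hh.self_of_nhds.exp.sub_const 1) e0).add
    ((hw₁.div hw.self_of_nhds w0).div_const 2))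
  obtain ⟨h3, h4⟩ := second_derivative_nonpos_of_isLocalMax h1 h2 hmax
  have hEpos := Real.exp_pos (h 0)
  have hexp : Real.exp (-h 0) = (Real.exp (h 0))⁻¹ := Real.exp_neg _
  have hE0 := hE 0 hpos
  rw [hexp]
  simp only [Pi.mul_apply] at h4
  generalize Real.exp (h 0) = E at *
  have hw0 := hwpos 0
  generalize w 0 = W at *
  generalize h₁ 0 = p at *
  generalize w₁ 0 = q at *
  have hp : p = -(1 - E⁻¹) * (q / (2 * W)) := by
    field_simp at h3 ⊢
    linarith
  refine ⟨hp, ?_⟩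
  have hq : q / (2 * W) = - (E * p / (E - 1)) := by
    rw [hp]; field_simp
  have hc : 0 < 1 - E⁻¹ := by
    have : 1 - E⁻¹ = (E - 1) / E := by field_simp
    rw [this]; positivity
  have h5 := mul_nonpos_of_nonneg_of_nonpos hc.le h4
  refine le_trans (le_of_eq ?_) h5
  have hq2 : q = -(E * p / (E - 1)) * (2 * W) := by rw [← hq]; field_simp
  rw [hq2]
  field_simp
  ring

theorem weighted_cauchy_schwarz {F μ p Φ : Fin n → ℝ} {N c K R : ℝ} (hF : ∀ i, 0 < F i)
    (hS : 0 < ∑ i, F i) (hN : ∀ i, μ i ≤ 0 → ∑ j, F j ≤ N * F i) (hN0 : 0 ≤ N) (hc : 0 ≤ c)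
    (hK : 0 ≤ K) (hΦ : ∀ i, Φ i = -c * (μ i * p i)) (hle : K * ∑ i, F i * Φ i ^ 2 ≤ R * ∑ i, F i)
    (hY : 0 ≤ ∑ i, p i * Φ i) :
    K * (∑ i, p i * Φ i) ^ 2 ≤ R * N * ∑ i, p i ^ 2 := by
  classical
  set s : Finset (Fin n) := Finset.univ.filter fun i => μ i ≤ 0
  -- For μ_i > 0 the summand is −c μ_i p_i² ≤ 0; the indices left are exactly those where `hN`
  -- applies.
  have h1 : ∑ i, p i * Φ i ≤ ∑ i ∈ s, p i * Φ i := by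
    rw [← Finset.sum_filter_add_sum_filter_not Finset.univ (fun i => μ i ≤ 0)]
    have : ∑ i ∈ Finset.univ.filter (fun i => ¬ μ i ≤ 0), p i * Φ i ≤ 0 := by
      refine Finset.sum_nonpos fun i hi => ?_
      have hi' := not_le.1 (Finset.mem_filter.1 hi).2
      rw [hΦ]
      have : 0 ≤ c * (μ i * p i ^ 2) := by positivity
      linarith
    linarith
  have h2 : (∑ i, p i * Φ i) ^ 2 ≤ (∑ i ∈ s, p i ^ 2) * ∑ i ∈ s, Φ i ^ 2 :=
    (pow_le_pow_left₀ hY h1 2).trans (Finset.sum_mul_sq_le_sq_mul_sq s p Φ)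
  have h3 : ∑ i ∈ s, p i ^ 2 ≤ ∑ i, p i ^ 2 :=
    Finset.sum_le_sum_of_subset_of_nonneg (Finset.subset_univ s) fun i _ _ => sq_nonneg _
  have h4 : (∑ i, F i) * ∑ i ∈ s, Φ i ^ 2 ≤ N * ∑ i, F i * Φ i ^ 2 := by
    rw [Finset.mul_sum, Finset.mul_sum]
    refine (Finset.sum_le_sum fun i hi => ?_).trans
      (Finset.sum_le_sum_of_subset_of_nonneg (Finset.subset_univ s) fun i _ _ => ?_)
    · rw [← mul_assoc]
      exact mul_le_mul_of_nonneg_right (hN i (Finset.mem_filter.1 hi).2) (sq_nonneg _)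
    · have := (hF i).le
      positivity
  have hp0 : 0 ≤ ∑ i, p i ^ 2 := Finset.sum_nonneg fun i _ => sq_nonneg _
  have hΦ0 : 0 ≤ ∑ i ∈ s, Φ i ^ 2 := Finset.sum_nonneg fun i _ => sq_nonneg _
  refine le_of_mul_le_mul_left ?_ hS
  calc (∑ i, F i) * (K * (∑ i, p i * Φ i) ^ 2)
      ≤ (∑ i, F i) * (K * ((∑ i, p i ^ 2) * ∑ i ∈ s, Φ i ^ 2)) := by
        gcongr
        exact h2.trans (mul_le_mul_of_nonneg_right h3 hΦ0)
    _ = K * (∑ i, p i ^ 2) * ((∑ i, F i) * ∑ i ∈ s, Φ i ^ 2) := by ring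
    _ ≤ K * (∑ i, p i ^ 2) * (N * ∑ i, F i * Φ i ^ 2) := by gcongr
    _ = (∑ i, p i ^ 2) * N * (K * ∑ i, F i * Φ i ^ 2) := by ring
    _ ≤ (∑ i, p i ^ 2) * N * (R * ∑ i, F i) := by gcongr
    _ = (∑ i, F i) * (R * N * ∑ i, p i ^ 2) := by ring

theorem barrier_arith {ρ a K N G W Y P : ℝ} (hρ : 0 < ρ) (ha : 0 < a) (hN : 0 < N)
    (hK : K = 41 * N / (a ^ 2 * ρ ^ 2)) (hG : 1 / 2 ≤ G) (hW : W = 1 + G ^ 2)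
    (hY : a * G ^ 2 / 2 ≤ W * Y) (hP : W * P = G ^ 2) (hCS : K * Y ^ 2 ≤ 2 / ρ ^ 2 * N * P) :
    False := by
  have hK0 : 0 < K := by rw [hK]; positivity
  have hG0 : 0 < G := by linarith
  have h1 : K * (a * G ^ 2 / 2) ^ 2 ≤ 2 / ρ ^ 2 * N * (W * G ^ 2) := by
    calc K * (a * G ^ 2 / 2) ^ 2 ≤ K * (W * Y) ^ 2 := by gcongr
      _ = W ^ 2 * (K * Y ^ 2) := by ring
      _ ≤ W ^ 2 * (2 / ρ ^ 2 * N * P) := by gcongr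
      _ = 2 / ρ ^ 2 * N * (W * (W * P)) := by ring
      _ = 2 / ρ ^ 2 * N * (W * G ^ 2) := by rw [hP]
  -- This uses G ≥ 1/2. The right side is then at most 10 N G⁴/ρ² and the left is (41/4) N G⁴/ρ²;
  -- any constant above 40 in K would do.
  have h2 : W ≤ 5 * G ^ 2 := by
    rw [hW]; nlinarith
  have h3 : 2 / ρ ^ 2 * N * (W * G ^ 2) ≤ 2 / ρ ^ 2 * N * (5 * G ^ 2 * G ^ 2) := by gcongr
  have h4 : K * (a * G ^ 2 / 2) ^ 2 = 41 / 4 * (N / ρ ^ 2 * G ^ 4) := by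
    rw [hK]; field_simp; norm_num
  have h5 : 2 / ρ ^ 2 * N * (5 * G ^ 2 * G ^ 2) = 10 * (N / ρ ^ 2 * G ^ 4) := by ring
  have h6 : 0 < N / ρ ^ 2 * G ^ 4 := by positivity
  linarith

/-- The cutoff function `1 - |y|² / ρ² + a (u y - M)`. -/
noncomputable def cutoff (u : EuclideanSpace ℝ (Fin n) → ℝ) (ρ a M : ℝ)
    (y : EuclideanSpace ℝ (Fin n)) : ℝ :=
  1 - ‖y‖ ^ 2 / ρ ^ 2 + a * (u y - M)

variable {u : EuclideanSpace ℝ (Fin n) → ℝ} {x : EuclideanSpace ℝ (Fin n)} {ρ a M K : ℝ}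

theorem barrier_max_along (hu : ∀ᶠ y in 𝓝 x, ContDiffAt ℝ 3 u y) (hK : 0 < K)
    (hpos : 0 < cutoff u ρ a M x)
    (hmax : IsLocalMax (fun y => Real.log (Real.exp (K * cutoff u ρ a M y) - 1) +
      Real.log (1 + ‖gradient u y‖ ^ 2) / 2) x) (v : EuclideanSpace ℝ (Fin n)) :
    let c := 1 - Real.exp (-(K * cutoff u ρ a M x))
    let ω := fderiv ℝ (fderiv ℝ u) x v (gradient u x) / (1 + ‖gradient u x‖ ^ 2)
    let Φ := -(2 * ⟪x, v⟫) / ρ ^ 2 + a * fderiv ℝ u x v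
    K * Φ = -c * ω ∧
      K * (-(2 * ‖v‖ ^ 2) / ρ ^ 2 + a * fderiv ℝ (fderiv ℝ u) x v v) + (K * Φ) ^ 2 +
        c * ((fderiv ℝ (fderiv ℝ (fderiv ℝ u)) x v v (gradient u x) +
          fderiv ℝ (fderiv ℝ u) x v
            ((InnerProductSpace.toDual ℝ _).symm (fderiv ℝ (fderiv ℝ u) x v))) /
          (1 + ‖gradient u x‖ ^ 2) - 3 * ω ^ 2) ≤ 0 := by
  intro c ω Φ
  have hline : ∀ s : ℝ, HasDerivAt (fun s : ℝ => x + s • v) v s := fun s => by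
    simpa using ((hasDerivAt_id s).smul_const v).const_add x
  have hcont : Tendsto (fun s : ℝ => x + s • v) (𝓝 0) (𝓝 x) := by
    have : Continuous fun s : ℝ => x + s • v := by fun_prop
    simpa using this.tendsto 0
  have hdual : ∀ s : ℝ, ContDiffAt ℝ 3 u (x + s • v) →
      HasDerivAt (fun s : ℝ => gradient u (x + s • v))
        ((InnerProductSpace.toDual ℝ _).symm (fderiv ℝ (fderiv ℝ u) (x + s • v) v)) s := by
    intro s hs
    have h1 := hasDerivAt_along (x := x) (v := v) (t := s) (f := fderiv ℝ u)
      ((contDiffAt_fderiv hs).differentiableAt (by norm_num))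
    exact ((InnerProductSpace.toDual ℝ
      (EuclideanSpace ℝ (Fin n))).symm.toContinuousLinearEquiv.toContinuousLinearMap).hasFDerivAt
      |>.comp_hasDerivAt s h1
  have hx := hu.self_of_nhds
  have hh : ∀ᶠ s in 𝓝 (0 : ℝ), HasDerivAt (fun s : ℝ => K * cutoff u ρ a M (x + s • v))
      (K * (-(2 * ⟪x + s • v, v⟫) / ρ ^ 2 + a * fderiv ℝ u (x + s • v) v)) s := by
    filter_upwards [hcont.eventually hu] with s hs
    have h1 := hasDerivAt_along (x := x) (v := v) (t := s) (f := u)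
      (hs.differentiableAt (by norm_num))
    have h2 := (((((hline s).norm_sq).div_const (ρ ^ 2)).const_sub 1).add
      ((h1.sub_const M).const_mul a)).const_mul K
    refine h2.congr_deriv ?_
    ring
  have hh₁ : HasDerivAt (fun s : ℝ => K * (-(2 * ⟪x + s • v, v⟫) / ρ ^ 2 +
      a * fderiv ℝ u (x + s • v) v))
      (K * (-(2 * ‖v‖ ^ 2) / ρ ^ 2 + a * fderiv ℝ (fderiv ℝ u) x v v)) 0 := by
    have h1 := hasDerivAt_along (x := x) (v := v) (t := 0) (f := fderiv ℝ u)
      (by simpa using (contDiffAt_fderiv hx).differentiableAt (by norm_num))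
    have h2 := h1.clm_apply (hasDerivAt_const 0 v)
    have h3 := (hline 0).inner ℝ (hasDerivAt_const 0 v)
    have h4 := ((((h3.const_mul 2).neg).div_const (ρ ^ 2)).add (h2.const_mul a)).const_mul K
    refine h4.congr_deriv ?_
    simp
  have hw : ∀ᶠ s in 𝓝 (0 : ℝ), HasDerivAt (fun s : ℝ => 1 + ‖gradient u (x + s • v)‖ ^ 2)
      (2 * fderiv ℝ (fderiv ℝ u) (x + s • v) v (gradient u (x + s • v))) s := by
    filter_upwards [hcont.eventually hu] with s hs
    refine ((hdual s hs).norm_sq.const_add 1).congr_deriv ?_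
    rw [real_inner_comm, InnerProductSpace.toDual_symm_apply]
  have hw₁ : HasDerivAt (fun s : ℝ => 2 * fderiv ℝ (fderiv ℝ u) (x + s • v) v
      (gradient u (x + s • v)))
      (2 * (fderiv ℝ (fderiv ℝ (fderiv ℝ u)) x v v (gradient u x) +
          fderiv ℝ (fderiv ℝ u) x v
            ((InnerProductSpace.toDual ℝ _).symm (fderiv ℝ (fderiv ℝ u) x v)))) 0 := by
    have h1 := hasDerivAt_along (x := x) (v := v) (t := 0) (f := fderiv ℝ (fderiv ℝ u))
      (by simpa using (contDiffAt_fderiv_fderiv hx).differentiableAt (by norm_num))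
    have h2 := ((h1.clm_apply (hasDerivAt_const 0 v)).clm_apply
      (hdual 0 (by simpa using hx))).const_mul 2
    refine h2.congr_deriv ?_
    simp
  have hmax' : IsLocalMax (fun s : ℝ => Real.log (Real.exp (K * cutoff u ρ a M (x + s • v)) - 1) +
      Real.log (1 + ‖gradient u (x + s • v)‖ ^ 2) / 2) 0 := by
    have := hcont.eventually hmax
    filter_upwards [this] with s hs
    simpa using hs
  have key := barrier_max hh hh₁ hw hw₁ (by simpa using mul_pos hK hpos)
    (fun s => by positivity) hmax'
  simp only [zero_smul, add_zero] at key
  obtain ⟨k1, k2⟩ := key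
  rw [mul_div_mul_left _ _ two_ne_zero] at k1 k2
  rw [mul_div_mul_left _ _ two_ne_zero] at k2
  exact ⟨k1, k2⟩

/-- At an interior maximum of the barrier, the gradient is controlled. -/
theorem gradient_lt_at_max {k : ℕ}
    (hu : ∀ᶠ y in 𝓝 x, ContDiffAt ℝ 3 u y ∧ InCone (k + 1) (principalCurvatures u y) ∧
      Q k (principalCurvatures u y) = 1 / areaElement u y)
    (hρ : 0 < ρ) (ha : 0 < a) (hxρ : ‖x‖ ≤ ρ)
    (hK : K = 41 * ((n + 1) * (k + 1)) / (a ^ 2 * ρ ^ 2))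
    (hpos : 0 < cutoff u ρ a M x)
    (hmax : IsLocalMax (fun y => Real.log (Real.exp (K * cutoff u ρ a M y) - 1) +
      Real.log (1 + ‖gradient u y‖ ^ 2) / 2) x) :
    ‖gradient u x‖ < 1 / 2 ∨ a * ρ * ‖gradient u x‖ < 4 := by
  by_contra! hcon
  obtain ⟨hg1, hg2⟩ := hcon
  obtain ⟨hx, hc, hQ⟩ := hu.self_of_nhds
  obtain ⟨e, μ, h⟩ := exists_isFrame hx
  have hμ := h.inCone hc
  have he := h.esymm_eq hc hQ
  -- Using n + 1 rather than n keeps N positive in every dimension.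
  set N : ℝ := (n + 1) * (k + 1) with hN
  have hN0 : 0 < N := by positivity
  have hK0 : 0 < K := by rw [hK]; positivity
  set F : Fin n → ℝ := fun i => cofactor k (others μ i)
  have hF : ∀ i, 0 < F i := cofactor_pos hμ he
  have hFμ : 0 < ∑ i, F i * μ i := sum_cofactor_mul_pos hμ he
  have hS : 0 < ∑ i, F i := by
    refine Finset.sum_pos (fun i _ => hF i) ?_
    by_contra hne
    rw [Finset.not_nonempty_iff_eq_empty.1 hne] at hFμ
    simp at hFμ
  set W : ℝ := 1 + ‖gradient u x‖ ^ 2 with hW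
  have hW0 : 0 < W := by positivity
  set p : Fin n → ℝ := fun i => fderiv ℝ u x (e i) with hp
  set c : ℝ := 1 - Real.exp (-(K * cutoff u ρ a M x)) with hcdef
  have hc0 : 0 < c := by
    have : Real.exp (-(K * cutoff u ρ a M x)) < 1 :=
      Real.exp_zero ▸ Real.exp_lt_exp.2 (neg_neg_of_pos (mul_pos hK0 hpos))
    linarith
  set Φ : Fin n → ℝ := fun i => -(2 * ⟪x, e i⟫) / ρ ^ 2 + a * p i with hΦ
  set T : Fin n → ℝ := fun i =>
    fderiv ℝ (fderiv ℝ (fderiv ℝ u)) x (gradient u x) (e i) (e i) with hT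
  have hω : ∀ i, fderiv ℝ (fderiv ℝ u) x (e i) (gradient u x) / W = μ i * p i := fun i => by
    rw [div_eq_iff hW0.ne', h.hess_gradient]
  have hmaxi := fun i => barrier_max_along (hu.mono fun y hy => hy.1) hK0 hpos hmax (e i)
  simp only [← hW, ← hcdef, hω, h.hess_dual, h.hess, if_true] at hmaxi
  have hΦ1 : ∀ i, K * Φ i = -c * (μ i * p i) := fun i => (hmaxi i).1
  have hthird : ∑ i, F i * (T i - 2 * W * (μ i ^ 2 * p i ^ 2)) = 0 := by
    rw [← h.sum_thirdDeriv hu (gradient u x)]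
    refine Finset.sum_congr rfl fun i _ => ?_
    rw [fderiv_fderiv_symm hx (gradient u x) (e i), h.hess_gradient]
    simp only [F, hT, hp]
    ring
  have hsum : ∑ i, F i * (K * (-(2 * ‖e i‖ ^ 2) / ρ ^ 2 + a * μ i) + (K * Φ i) ^ 2 +
      c * ((T i + μ i ^ 2 * (1 + p i ^ 2 * W)) / W - 3 * (μ i * p i) ^ 2)) ≤ 0 :=
    Finset.sum_nonpos fun i _ => mul_nonpos_of_nonneg_of_nonpos (hF i).le (by
      have := (hmaxi i).2
      rw [thirdDeriv_symm hx] at this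
      exact this)
  -- The exact cancellation: the differentiated equation replaces T_i/W by 2μ_i²p_i², the Hessian
  -- term adds μ_i²p_i² + μ_i²/W, and −3μ_i²p_i² leaves only μ_i²/W ≥ 0.
  have hsplit : ∑ i, F i * (K * (-(2 * ‖e i‖ ^ 2) / ρ ^ 2 + a * μ i) + (K * Φ i) ^ 2 +
      c * ((T i + μ i ^ 2 * (1 + p i ^ 2 * W)) / W - 3 * (μ i * p i) ^ 2)) =
      K * (-(2 / ρ ^ 2 * ∑ i, F i * ‖e i‖ ^ 2) + a * ∑ i, F i * μ i +
        K * ∑ i, F i * Φ i ^ 2) + c / W * ∑ i, F i * μ i ^ 2 +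
      c / W * ∑ i, F i * (T i - 2 * W * (μ i ^ 2 * p i ^ 2)) := by
    simp only [Finset.mul_sum, ← Finset.sum_neg_distrib, ← Finset.sum_add_distrib]
    refine Finset.sum_congr rfl fun i _ => ?_
    field_simp
    ring
  rw [hsplit, hthird, mul_zero, add_zero] at hsum
  have hFμ2 : 0 ≤ ∑ i, F i * μ i ^ 2 :=
    Finset.sum_nonneg fun i _ => mul_nonneg (hF i).le (sq_nonneg _)
  have hFe : ∑ i, F i * ‖e i‖ ^ 2 ≤ ∑ i, F i :=
    Finset.sum_le_sum fun i _ => mul_le_of_le_one_right (hF i).le (h.norm_sq_le i)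
  have hle : K * ∑ i, F i * Φ i ^ 2 ≤ 2 / ρ ^ 2 * ∑ i, F i := by
    have h1 : 0 ≤ c / W * ∑ i, F i * μ i ^ 2 := by positivity
    have h2 : -(2 / ρ ^ 2 * ∑ i, F i * ‖e i‖ ^ 2) + a * ∑ i, F i * μ i +
        K * ∑ i, F i * Φ i ^ 2 ≤ 0 := by
      by_contra! hlt
      have := mul_pos hK0 hlt
      linarith
    have h3 : 2 / ρ ^ 2 * ∑ i, F i * ‖e i‖ ^ 2 ≤ 2 / ρ ^ 2 * ∑ i, F i := by gcongr
    have h4 := mul_pos ha hFμ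
    linarith
  set G : ℝ := ‖gradient u x‖ with hG
  have hG0 : 0 < G := by linarith
  have hsq := h.sum_sq
  have hY : W * ∑ i, p i * Φ i = -(2 * ⟪x, gradient u x⟫) / ρ ^ 2 + a * G ^ 2 := by
    have h1 : ⟪x, gradient u x⟫ = W * ∑ i, p i * ⟪x, e i⟫ := by
      conv_lhs => rw [h.gradient_eq]
      simp only [inner_smul_right, inner_sum]
      rfl
    rw [h1, ← hsq]
    simp only [hΦ, Finset.mul_sum, neg_div, Finset.sum_div, ← Finset.sum_neg_distrib,
      ← Finset.sum_add_distrib]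
    refine Finset.sum_congr rfl fun i _ => ?_
    ring
  have hYge : a * G ^ 2 / 2 ≤ W * ∑ i, p i * Φ i := by
    rw [hY]
    have h1 : ⟪x, gradient u x⟫ ≤ ρ * G :=
      (real_inner_le_norm _ _).trans (mul_le_mul_of_nonneg_right hxρ hG0.le)
    have h2 : (2 * ⟪x, gradient u x⟫) / ρ ^ 2 ≤ 2 * G / ρ := by
      rw [div_le_div_iff₀ (by positivity) hρ]
      nlinarith
    -- This is the assumption aρG ≥ 4: half of aG² absorbs the radial part of the cutoff.
    have h3 : 2 * G / ρ ≤ a * G ^ 2 / 2 := by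
      rw [div_le_div_iff₀ hρ two_pos]
      nlinarith
    rw [neg_div]
    linarith
  have hYpos : 0 ≤ W * ∑ i, p i * Φ i := le_trans (by positivity) hYge
  have hCS := weighted_cauchy_schwarz (c := c / K) hF hS
    (fun i hi => sum_cofactor_le_of_nonpos hμ he i hi) hN0.le (by positivity) hK0.le
    (fun i => by
      have := hΦ1 i
      field_simp
      linarith) hle (nonneg_of_mul_nonneg_right hYpos hW0)
  exact barrier_arith hρ ha hN0 hK hg1 hW hYge hsq hCS

end

end QkTranslator

/-! ### From the maximum point to the centre. -/

namespace QkTranslator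

open Filter Topology

variable {n : ℕ}

/-- The bounds e^{Kφ₀} − 1 ≥ 4K/5 and e^{Kφ₁} − 1 ≤ K e^K share the factor K, which cancels, so no
lower bound on K is needed. -/
theorem le_exp_of_barrier_le {K q w₀ w₁ g φ₀ φ₁ : ℝ} (hK : 0 < K) (hφ₀ : 4 / 5 ≤ φ₀)
    (hφ₁ : φ₁ ≤ 1) (hw₀ : w₀ = 1 + g ^ 2) (hw₁ : 0 ≤ w₁) (hle : w₁ ≤ 5 / 4 + 400 * q)
    (h : (Real.exp (K * φ₀) - 1) * Real.sqrt w₀ ≤ (Real.exp (K * φ₁) - 1) * Real.sqrt w₁) :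
    g ≤ Real.exp (2 * K + 320 * q) := by
  have h0 : K * (4 / 5) ≤ Real.exp (K * φ₀) - 1 := by
    have h1 := Real.add_one_le_exp (K * φ₀)
    have h2 : K * (4 / 5) ≤ K * φ₀ := by gcongr
    linarith
  have h1 : Real.exp (K * φ₁) - 1 ≤ K * Real.exp K := by
    have h2 : Real.exp (K * φ₁) ≤ Real.exp K := Real.exp_le_exp.2 (by nlinarith)
    have h3 := Real.add_one_le_exp (-K)
    have h4 : Real.exp K * Real.exp (-K) = 1 := by rw [← Real.exp_add]; simp
    nlinarith [Real.exp_pos K]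
  have h2 : K * (4 / 5 * Real.sqrt w₀) ≤ K * (Real.exp K * Real.sqrt w₁) := by
    have := (mul_le_mul_of_nonneg_right h0 (Real.sqrt_nonneg w₀)).trans
      (h.trans (mul_le_mul_of_nonneg_right h1 (Real.sqrt_nonneg w₁)))
    linarith
  have h3 := le_of_mul_le_mul_left h2 hK
  have h4 := pow_le_pow_left₀ (by positivity) h3 2
  rw [mul_pow, mul_pow, Real.sq_sqrt hw₁, Real.sq_sqrt (by rw [hw₀]; positivity)] at h4
  have h5 : Real.exp K ^ 2 = Real.exp (2 * K) := by rw [← Real.exp_nat_mul]; norm_num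
  rw [h5] at h4
  have hE := Real.exp_pos (2 * K)
  set z := Real.exp (2 * K + 320 * q) with hz
  have h6 : Real.exp (2 * K) * (1 + 320 * q) ≤ z := by
    rw [hz, Real.exp_add]
    have := Real.add_one_le_exp (320 * q)
    gcongr
    linarith
  have h7 : Real.exp (2 * K) * w₁ ≤ Real.exp (2 * K) * (5 / 4 * (1 + 320 * q)) := by
    gcongr; linarith
  -- The previous bounds give 1 + g² ≤ (125/64) z < 2z, and 2z − 1 ≤ z².
  have h8 : g ^ 2 ≤ z ^ 2 := by
    have hz0 : 0 < z := Real.exp_pos _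
    nlinarith [sq_nonneg (z - 1)]
  exact le_of_sq_le_sq h8 (Real.exp_pos _).le

theorem norm_gradient_le_of_lt {k : ℕ} {r ρ M : ℝ} {u : EuclideanSpace ℝ (Fin n) → ℝ} (hρ : 0 < ρ)
    (hρr : ρ < r) (hM : 0 < M) (hu : ContDiffOn ℝ 3 u (Metric.ball 0 r))
    (hnonneg : ∀ x ∈ Metric.ball (0 : EuclideanSpace ℝ (Fin n)) r, 0 ≤ u x)
    (hle : ∀ x ∈ Metric.ball (0 : EuclideanSpace ℝ (Fin n)) r, u x ≤ M)
    (hcone : ∀ x ∈ Metric.ball (0 : EuclideanSpace ℝ (Fin n)) r,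
      InCone (k + 1) (principalCurvatures u x))
    (hQ : IsGraphTranslatorOn k u (Metric.ball 0 r)) :
    ‖gradient u 0‖ ≤ Real.exp ((2050 * ((n + 1) * (k + 1)) + 320) * M ^ 2 / ρ ^ 2) := by
  -- Then aM = 1/5, so φ(0) ≥ 4/5 while φ ≤ 1 − |y|²/ρ².
  set a : ℝ := 1 / (5 * M) with ha
  have ha0 : 0 < a := by positivity
  set K : ℝ := 41 * ((n + 1) * (k + 1)) / (a ^ 2 * ρ ^ 2) with hK
  have hK0 : 0 < K := by positivity
  have hball : ∀ y ∈ Metric.closedBall (0 : EuclideanSpace ℝ (Fin n)) ρ, y ∈ Metric.ball 0 r :=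
    Metric.closedBall_subset_ball hρr
  have hC : ∀ y ∈ Metric.ball (0 : EuclideanSpace ℝ (Fin n)) r, ContDiffAt ℝ 3 u y :=
    fun y hy => hu.contDiffAt (Metric.isOpen_ball.mem_nhds hy)
  have hgrad : ∀ y ∈ Metric.ball (0 : EuclideanSpace ℝ (Fin n)) r,
      ContinuousAt (gradient u) y := fun y hy =>
    (InnerProductSpace.toDual ℝ (EuclideanSpace ℝ (Fin n))).symm.continuous.continuousAt.comp
      (contDiffAt_fderiv (hC y hy)).continuousAt
  set φ := cutoff u ρ a M with hφ
  have hφcont : ∀ y ∈ Metric.ball (0 : EuclideanSpace ℝ (Fin n)) r, ContinuousAt φ y := by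
    intro y hy
    have := (hC y hy).continuousAt
    unfold φ cutoff
    fun_prop
  set Ψ : EuclideanSpace ℝ (Fin n) → ℝ := fun y =>
    (Real.exp (K * φ y) - 1) * Real.sqrt (1 + ‖gradient u y‖ ^ 2) with hΨ
  have hΨcont : ContinuousOn Ψ (Metric.closedBall 0 ρ) := fun y hy => by
    have h1 := hφcont y (hball y hy)
    have h2 := hgrad y (hball y hy)
    refine ContinuousAt.continuousWithinAt ?_
    unfold Ψ
    fun_prop
  have h0mem : (0 : EuclideanSpace ℝ (Fin n)) ∈ Metric.closedBall 0 ρ := by simp [hρ.le]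
  obtain ⟨x, hxmem, hxmax⟩ := (isCompact_closedBall (0 : EuclideanSpace ℝ (Fin n)) ρ).exists_isMaxOn
    ⟨0, h0mem⟩ hΨcont
  have hxr := hball x hxmem
  have haM : a * M = 1 / 5 := by rw [ha]; field_simp
  have hφ0 : 4 / 5 ≤ φ 0 := by
    have h1 : 0 ≤ a * u 0 := mul_nonneg ha0.le (hnonneg 0 (hball 0 h0mem))
    have : φ 0 = 1 + a * u 0 - a * M := by simp [φ, cutoff]; ring
    rw [this, haM]; linarith
  have hφle : ∀ y ∈ Metric.ball (0 : EuclideanSpace ℝ (Fin n)) r,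
      φ y ≤ 1 - ‖y‖ ^ 2 / ρ ^ 2 := fun y hy => by
    have : a * (u y - M) ≤ 0 :=
      mul_nonpos_of_nonneg_of_nonpos ha0.le (sub_nonpos.2 (hle y hy))
    simp only [φ, cutoff]
    linarith
  have hE : ∀ t : ℝ, 0 < t → 0 < Real.exp t - 1 := fun t ht => by
    have := Real.add_one_lt_exp ht.ne'
    linarith
  have hw : ∀ y, 0 < Real.sqrt (1 + ‖gradient u y‖ ^ 2) := fun y =>
    Real.sqrt_pos.2 (by positivity)
  have hΨ0 : 0 < Ψ 0 := mul_pos (hE _ (mul_pos hK0 (by linarith))) (hw 0)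
  have hΨx : 0 < Ψ x := hΨ0.trans_le (hxmax h0mem)
  have hφx : 0 < φ x := by
    have h1 := pos_of_mul_pos_left hΨx (hw x).le
    by_contra! hneg
    have : Real.exp (K * φ x) ≤ 1 :=
      Real.exp_le_one_iff.2 (mul_nonpos_of_nonneg_of_nonpos hK0.le hneg)
    linarith
  have hxlt : ‖x‖ < ρ := by
    have h1 := hφx.trans_le (hφle x hxr)
    rw [sub_pos, div_lt_one (by positivity)] at h1
    exact lt_of_pow_lt_pow_left₀ 2 hρ.le h1
  have hmax : IsLocalMax (fun y => Real.log (Real.exp (K * cutoff u ρ a M y) - 1) +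
      Real.log (1 + ‖gradient u y‖ ^ 2) / 2) x := by
    have hlog : ∀ y, 0 < φ y → Real.log (Real.exp (K * cutoff u ρ a M y) - 1) +
      Real.log (1 + ‖gradient u y‖ ^ 2) / 2 = Real.log (Ψ y) := fun y hy => by
      rw [hΨ, Real.log_mul (hE _ (mul_pos hK0 hy)).ne' (hw y).ne',
        Real.log_sqrt (by positivity)]
    have hxball : Metric.ball (0 : EuclideanSpace ℝ (Fin n)) ρ ∈ 𝓝 x :=
      Metric.isOpen_ball.mem_nhds (by simpa using hxlt)
    filter_upwards [hxball, (hφcont x hxr).eventually (lt_mem_nhds hφx)] with y hy hφy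
    rw [hlog y hφy, hlog x hφx]
    exact Real.log_le_log (mul_pos (hE _ (mul_pos hK0 hφy)) (hw y))
      (hxmax (Metric.ball_subset_closedBall hy))
  have hev : ∀ᶠ y in 𝓝 x, ContDiffAt ℝ 3 u y ∧ InCone (k + 1) (principalCurvatures u y) ∧
      Q k (principalCurvatures u y) = 1 / areaElement u y := by
    filter_upwards [Metric.isOpen_ball.mem_nhds hxr] with y hy
    exact ⟨hC y hy, hcone y hy, hQ y hy⟩
  have hbound : 1 + ‖gradient u x‖ ^ 2 ≤ 5 / 4 + 400 * (M ^ 2 / ρ ^ 2) := by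
    have hq : 0 ≤ M ^ 2 / ρ ^ 2 := by positivity
    rcases gradient_lt_at_max hev hρ ha0 hxlt.le hK hφx hmax with h1 | h1
    · nlinarith [norm_nonneg (gradient u x)]
    · have h2 : ‖gradient u x‖ ≤ 20 * M / ρ := by
        rw [le_div_iff₀ hρ]
        have h3 : a * ρ * ‖gradient u x‖ * (5 * M) = ‖gradient u x‖ * ρ := by
          rw [ha]; field_simp
        nlinarith
      have h3 := pow_le_pow_left₀ (norm_nonneg _) h2 2
      have h4 : (20 * M / ρ) ^ 2 = 400 * (M ^ 2 / ρ ^ 2) := by ring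
      linarith
  have hφ1 : φ x ≤ 1 := (hφle x hxr).trans (by
    have : 0 ≤ ‖x‖ ^ 2 / ρ ^ 2 := by positivity
    linarith)
  have key := le_exp_of_barrier_le hK0 hφ0 hφ1 rfl (by positivity) hbound (hxmax h0mem)
  refine key.trans_eq ?_
  congr 1
  -- 2K = 2 · 41 · 25 (n+1)(k+1) M²/ρ², whence 2050.
  rw [hK, ha]
  field_simp
  ring

end QkTranslator

theorem theorem3p4 (n k : ℕ) :
    ∃ C : ℝ, 0 < C ∧
      ∀ (r : ℝ) (u : EuclideanSpace ℝ (Fin n) → ℝ) (M : ℝ),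
        0 < r →
        ContDiffOn ℝ 3 u (Metric.ball 0 r) →
        (∀ x ∈ Metric.ball (0 : EuclideanSpace ℝ (Fin n)) r, 0 ≤ u x) →
        (∀ x ∈ Metric.ball (0 : EuclideanSpace ℝ (Fin n)) r,
          QkTranslator.InCone (k + 1) (QkTranslator.principalCurvatures u x)) →
        QkTranslator.IsGraphTranslatorOn k u (Metric.ball 0 r) →
        IsLUB (u '' Metric.ball 0 r) M →
        ‖gradient u 0‖ ≤ Real.exp (C * M / r + C * M ^ 2 / r ^ 2) := by
  set C : ℝ := 2050 * ((n + 1) * (k + 1)) + 320 with hC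
  have hC0 : 0 < C := by positivity
  refine ⟨C, hC0, fun r u M hr hu hnonneg hcone hQ hM => ?_⟩
  have hle : ∀ x ∈ Metric.ball (0 : EuclideanSpace ℝ (Fin n)) r, u x ≤ M :=
    fun x hx => hM.1 (Set.mem_image_of_mem u hx)
  have h0 : (0 : EuclideanSpace ℝ (Fin n)) ∈ Metric.ball 0 r := Metric.mem_ball_self hr
  -- For M = 0 the choice a = 1/(5M) is unavailable, but u vanishes identically on the ball.
  rcases ((hnonneg 0 h0).trans (hle 0 h0)).eq_or_lt with hM0 | hM0
  · have hev : u =ᶠ[nhds 0] fun _ => 0 := by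
      filter_upwards [Metric.ball_mem_nhds 0 hr] with x hx
      exact le_antisymm ((hle x hx).trans_eq hM0.symm) (hnonneg x hx)
    have : gradient u 0 = 0 := by simp [gradient, hev.fderiv_eq]
    rw [this, norm_zero]
    exact (Real.exp_pos _).le
  · have hlim : Filter.Tendsto (fun ρ : ℝ => Real.exp (C * M ^ 2 / ρ ^ 2)) (nhdsWithin r (Set.Iio r))
        (nhds (Real.exp (C * M ^ 2 / r ^ 2))) := by
      have : ContinuousAt (fun ρ : ℝ => Real.exp (C * M ^ 2 / ρ ^ 2)) r := by
        have : r ^ 2 ≠ 0 := by positivity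
        fun_prop (disch := assumption)
      exact this.tendsto.mono_left nhdsWithin_le_nhds
    have h1 : ‖gradient u 0‖ ≤ Real.exp (C * M ^ 2 / r ^ 2) := by
      refine ge_of_tendsto hlim ?_
      filter_upwards [Ioo_mem_nhdsLT hr] with ρ hρ
      exact QkTranslator.norm_gradient_le_of_lt hρ.1 hρ.2 hM0 hu hnonneg hle hcone hQ
    refine h1.trans (Real.exp_le_exp.2 ?_)
    have : 0 ≤ C * M / r := by positivity
    linarith
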